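/- Let $N\ge 1$ be an integer, $p\ge 2$ and $0<\alpha<N$ real. On the lattice graph $\mathbb{Z}^N$ (with $x\sim y$ iff $\sum_i|x_i-y_i|=1$) put $$\nabla u\nabla v(x)=\tfrac12\sum_{y\sim x}(u(y)-u(x))(v(y)-v(x)),\qquad |\nabla u|(x)=\Big(\tfrac12\sum_{y\sim x}(u(y)-u(x))^2\Big)^{1/2},$$ $$\Delta_p u(x)=\tfrac12\sum_{y\sim x}\big(|\nabla u|^{p-2}(y)+|\nabla u|^{p-2}(x)\big)(u(y)-u(x)),$$ and let $$R_\alpha(x,y)=\frac{K_\alpha}{(2\pi)^N}\int_{[0,2\pi]^N}e^{i(x-y)\cdot k}\mu(k)^{-\alpha/2}\,dk,\quad K_\alpha=\frac1{(2\pi)^N}\int_{[0,2\pi]^N}\mu(k)^{\alpha/2}\,dk,\quad \mu(k)=2N-2\sum_{j=1}^N\cos k_j,$$ with $(R_\alpha*g)(x)=\sum_{y}R_\alpha(x,y)g(y)$. Let $h:\mathbb{Z}^N\to\mathbb{R}$ satisfy * $(h_1)$ there is $h_0>0$ with $h(x)\ge h_0$ for all $x$; * $(h_2)$ there is a nonzero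 integer $T$ with $h(x+Tk)=h(x)$ for all $x,k\in\mathbb{Z}^N$. Let $W^{1,p}(\mathbb{Z}^N)$ be the completion of the finitely supported functions in the norm $\big(\sum_x(|\nabla u|^p+|u|^p)\big)^{1/p}$, and let $H=\{u\in W^{1,p}(\mathbb{Z}^N):\sum_x h|u|^p<\infty\}$ with the norm $\|u\|=\big(\sum_x(|\nabla u|^p+h|u|^p)\big)^{1/p}$. Let $f:\mathbb{R}\to\mathbb{R}$, $F(t)=\int_0^t f(s)\,ds$, satisfy * $(f_1)$ $f$ is continuous and $f(t)=o(|t|^{p-1})$ as $t\to0$; * $(f_2)$ there are $C>0$ and $\tau>\frac{(N+\alpha)p}{2N}$ with $|f(t)|\le C(1+|t|^{\tau-1})$ for all $t\in\mathbb{R}$; * $(f_3)$ there is $\theta>p$ with $0\le\theta F(t)\le 2f(t)t$ for all $t\in\mathbb{R}$; * $(f_4)$ for every $u\in H\setminus\{0\}$ the function $t\mapsto t^{-p}\sum_{x}(R_\alpha*F(tu))(x)\,f(tu(x))\,u(x)$ is strictly increasing on $(0,\infty)$. Then the functional $$J(u)=\frac1p\sum_x\big(|\nabla u|^p+h|u|^p\big)-\frac12\sum_x(R_\alpha*F(u))F(u)$$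 is of class $C^1$ on $H$, and the equation $$-\Delta_p u+h|u|^{p-2}u=(R_\alpha*F(u))f(u)\quad\text{on }\mathbb{Z}^N$$ has a ground state solution: there is $u\in H\setminus\{0\}$ with $J'(u)=0$ and $J(u)=\min_{\mathcal M}J$, where $\mathcal M=\{v\in H\setminus\{0\}:\langle J'(v),v\rangle=0\}$ is the Nehari manifold, and $u$ satisfies the equation at every point of $\mathbb{Z}^N$. -/

import Mathlib

open Filter Topology MeasureTheory

noncomputable section

namespace Choquard

variable {N : ℕ}

/-- The neighbours of a vertex `x` of the lattice graph `ℤ^N`; see `mem_nbrs`. -/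
def nbrs (x : Fin N → ℤ) : Finset (Fin N → ℤ) :=
  (Fintype.piFinset fun i => Finset.Icc (x i - 1) (x i + 1)).filter
    fun y => ∑ i, |x i - y i| = 1

theorem mem_nbrs (x y : Fin N → ℤ) : y ∈ nbrs x ↔ ∑ i, |x i - y i| = 1 := by
  simp only [nbrs, Finset.mem_filter, Fintype.mem_piFinset, Finset.mem_Icc]
  refine ⟨fun h => h.2, fun h => ⟨fun i => ?_, h⟩⟩
  have h1 : |x i - y i| ≤ 1 :=
    h ▸ Finset.single_le_sum (f := fun i => |x i - y i|) (fun j _ => abs_nonneg _)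
      (Finset.mem_univ i)
  rw [abs_le] at h1
  constructor <;> linarith [h1.1, h1.2]

/-- The gradient form `Γ(u, v)(x) = ½ ∑_{y ∼ x} (u y - u x) (v y - v x)`. -/
def gradForm (u v : (Fin N → ℤ) → ℝ) (x : Fin N → ℤ) : ℝ :=
  (1 / 2) * ∑ y ∈ nbrs x, (u y - u x) * (v y - v x)

/-- The length of the gradient `|∇u|(x) = √Γ(u, u)(x)`. -/
def gradNorm (u : (Fin N → ℤ) → ℝ) (x : Fin N → ℤ) : ℝ :=
  √(gradForm u u x)

/-- The `p`-Laplacian of the lattice graph. -/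
def pLaplacian (p : ℝ) (u : (Fin N → ℤ) → ℝ) (x : Fin N → ℤ) : ℝ :=
  (1 / 2) * ∑ y ∈ nbrs x, (gradNorm u y ^ (p - 2) + gradNorm u x ^ (p - 2)) * (u y - u x)

/-- `|∇u|^p + h |u|^p`, the density of the `p`-th power of the norm with weight `h`. -/
def density (p : ℝ) (h u : (Fin N → ℤ) → ℝ) (x : Fin N → ℤ) : ℝ :=
  gradNorm u x ^ p + h x * |u x| ^ p

/-- `(∑ (|∇u|^p + h |u|^p))^(1/p)`; meaningful when the density is summable. -/
def wnorm (p : ℝ) (h u : (Fin N → ℤ) → ℝ) : ℝ :=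
  (∑' x, density p h u x) ^ (1 / p)

/-- Membership in `W^{1,p}(ℤ^N)`, the completion of the finitely supported functions for the
norm `(∑ (|∇u|^p + |u|^p))^(1/p)`. As this norm dominates every point evaluation, the completion is
the space of functions of finite norm that are limits of finitely supported ones. -/
def MemW (p : ℝ) (u : (Fin N → ℤ) → ℝ) : Prop :=
  Summable (density p 1 u) ∧
    ∀ ε > 0, ∃ φ : (Fin N → ℤ) → ℝ, φ.support.Finite ∧
      Summable (density p 1 (u - φ)) ∧ wnorm p 1 (u - φ) < ε

/-! ### Facts that make `H` a normed space -/

theorem gradNorm_nonneg (u : (Fin N → ℤ) → ℝ) (x) : 0 ≤ gradNorm u x := Real.sqrt_nonneg _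

theorem gradNorm_eq (u : (Fin N → ℤ) → ℝ) (x) :
    gradNorm u x = √(1 / 2) * √(∑ y ∈ nbrs x, (u y - u x) ^ 2) := by
  rw [gradNorm, gradForm, Real.sqrt_mul (by norm_num)]
  simp only [pow_two]

theorem gradNorm_add_le (u v : (Fin N → ℤ) → ℝ) (x) :
    gradNorm (u + v) x ≤ gradNorm u x + gradNorm v x := by
  have key := Real.Lp_add_le (nbrs x) (fun y => u y - u x) (fun y => v y - v x)
    (p := 2) (by norm_num)
  simp only [Real.rpow_two, sq_abs, ← Real.sqrt_eq_rpow] at key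
  rw [gradNorm_eq, gradNorm_eq, gradNorm_eq, ← mul_add]
  refine mul_le_mul_of_nonneg_left ?_ (Real.sqrt_nonneg _)
  refine le_trans (le_of_eq ?_) key
  refine congrArg Real.sqrt (Finset.sum_congr rfl fun y _ => ?_)
  simp only [Pi.add_apply]
  ring

theorem gradNorm_smul (c : ℝ) (u : (Fin N → ℤ) → ℝ) (x) :
    gradNorm (c • u) x = |c| * gradNorm u x := by
  rw [gradNorm_eq, gradNorm_eq, ← Real.sqrt_sq_eq_abs c]
  have : ∑ y ∈ nbrs x, ((c • u) y - (c • u) x) ^ 2 = c ^ 2 * ∑ y ∈ nbrs x, (u y - u x) ^ 2 := by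
    rw [Finset.mul_sum]
    refine Finset.sum_congr rfl fun y _ => ?_
    simp only [Pi.smul_apply, smul_eq_mul]
    ring
  rw [this, Real.sqrt_mul (sq_nonneg c)]
  ring

theorem density_nonneg {p : ℝ} {h : (Fin N → ℤ) → ℝ} (hh : ∀ x, 0 ≤ h x)
    (u : (Fin N → ℤ) → ℝ) (x) : 0 ≤ density p h u x :=
  add_nonneg (Real.rpow_nonneg (gradNorm_nonneg _ _) _)
    (mul_nonneg (hh x) (Real.rpow_nonneg (abs_nonneg _) _))

theorem density_smul {p : ℝ} (h : (Fin N → ℤ) → ℝ) (c : ℝ) (u : (Fin N → ℤ) → ℝ) (x) :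
    density p h (c • u) x = |c| ^ p * density p h u x := by
  rw [density, density, gradNorm_smul, Real.mul_rpow (abs_nonneg _) (gradNorm_nonneg _ _),
    Pi.smul_apply, smul_eq_mul, abs_mul, Real.mul_rpow (abs_nonneg _) (abs_nonneg _)]
  ring

theorem density_rpow {p : ℝ} (hp : 2 ≤ p) {h : (Fin N → ℤ) → ℝ} (hh : ∀ x, 0 ≤ h x)
    (u : (Fin N → ℤ) → ℝ) (x) : (density p h u x ^ (1 / p)) ^ p = density p h u x := by
  rw [← Real.rpow_mul (density_nonneg hh u x), one_div_mul_cancel (by linarith), Real.rpow_one]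

theorem density_add_le {p : ℝ} (hp : 2 ≤ p) {h : (Fin N → ℤ) → ℝ} (hh : ∀ x, 0 ≤ h x)
    (u v : (Fin N → ℤ) → ℝ) (x) :
    density p h (u + v) x ^ (1 / p) ≤ density p h u x ^ (1 / p) + density p h v x ^ (1 / p) := by
  have hp0 : 0 < p := by linarith
  have e : ∀ t : ℝ, 0 ≤ t → (h x ^ (1 / p) * t) ^ p = h x * t ^ p := fun t ht => by
    rw [Real.mul_rpow (Real.rpow_nonneg (hh x) _) ht, ← Real.rpow_mul (hh x),
      one_div_mul_cancel hp0.ne', Real.rpow_one]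
  have hr : 0 ≤ h x ^ (1 / p) := Real.rpow_nonneg (hh x) _
  have key := Real.Lp_add_le_of_nonneg (Finset.univ : Finset (Fin 2)) (p := p) (by linarith)
    (f := ![gradNorm u x, h x ^ (1 / p) * |u x|]) (g := ![gradNorm v x, h x ^ (1 / p) * |v x|])
    (by
      intro i _
      fin_cases i
      · exact gradNorm_nonneg _ _
      · exact mul_nonneg hr (abs_nonneg _))
    (by
      intro i _
      fin_cases i
      · exact gradNorm_nonneg _ _
      · exact mul_nonneg hr (abs_nonneg _))
  simp only [Fin.sum_univ_two, Matrix.cons_val_zero, Matrix.cons_val_one, ← mul_add] at key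
  rw [e _ (abs_nonneg _), e _ (abs_nonneg _), e _ (by positivity)] at key
  refine le_trans (Real.rpow_le_rpow (density_nonneg hh _ _) ?_ (by positivity)) key
  refine add_le_add (Real.rpow_le_rpow (gradNorm_nonneg _ _) (gradNorm_add_le u v x) hp0.le)
    (mul_le_mul_of_nonneg_left (Real.rpow_le_rpow (abs_nonneg _) (abs_add_le _ _) hp0.le) (hh x))

theorem wnorm_add {p : ℝ} (hp : 2 ≤ p) {h : (Fin N → ℤ) → ℝ} (hh : ∀ x, 0 ≤ h x)
    {u v : (Fin N → ℤ) → ℝ} (hu : Summable (density p h u)) (hv : Summable (density p h v)) :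
    Summable (density p h (u + v)) ∧ wnorm p h (u + v) ≤ wnorm p h u + wnorm p h v := by
  have hp0 : 0 < p := by linarith
  have nn : ∀ (w : (Fin N → ℤ) → ℝ) x, 0 ≤ density p h w x ^ (1 / p) := fun w x =>
    Real.rpow_nonneg (density_nonneg hh w x) _
  have key := Real.Lp_add_le_tsum_of_nonneg (p := p) (by linarith) (nn u) (nn v)
    (by simpa only [density_rpow hp hh] using hu) (by simpa only [density_rpow hp hh] using hv)
  simp only [density_rpow hp hh] at key
  have le : ∀ x, density p h (u + v) x ≤
      (density p h u x ^ (1 / p) + density p h v x ^ (1 / p)) ^ p := fun x => by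
    rw [← density_rpow hp hh (u + v) x]
    exact Real.rpow_le_rpow (nn _ _) (density_add_le hp hh u v x) hp0.le
  have hs : Summable (density p h (u + v)) :=
    Summable.of_nonneg_of_le (density_nonneg hh _) le key.1
  exact ⟨hs, le_trans (Real.rpow_le_rpow (tsum_nonneg (density_nonneg hh _))
    (hs.tsum_le_tsum le key.1) (by positivity)) key.2⟩

theorem summable_smul {p : ℝ} {h : (Fin N → ℤ) → ℝ} (c : ℝ)
    {u : (Fin N → ℤ) → ℝ} (hu : Summable (density p h u)) : Summable (density p h (c • u)) := by
  simpa only [← density_smul] using hu.mul_left (|c| ^ p)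

theorem wnorm_smul {p : ℝ} (hp : 2 ≤ p) {h : (Fin N → ℤ) → ℝ} (hh : ∀ x, 0 ≤ h x) (c : ℝ)
    (u : (Fin N → ℤ) → ℝ) : wnorm p h (c • u) = |c| * wnorm p h u := by
  simp only [wnorm, density_smul, tsum_mul_left]
  rw [Real.mul_rpow (Real.rpow_nonneg (abs_nonneg _) _) (tsum_nonneg (density_nonneg hh _)),
    ← Real.rpow_mul (abs_nonneg _), mul_one_div_cancel (by linarith), Real.rpow_one]

theorem density_zero {p : ℝ} (hp : 2 ≤ p) (h : (Fin N → ℤ) → ℝ) : density p h 0 = 0 := by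
  funext x
  have hp0 : p ≠ 0 := by linarith
  simp [density, gradNorm, gradForm, Real.zero_rpow hp0]

theorem wnorm_zero {p : ℝ} (hp : 2 ≤ p) (h : (Fin N → ℤ) → ℝ) : wnorm p h 0 = 0 := by
  have hp0 : p ≠ 0 := by linarith
  simp [wnorm, density_zero hp, Real.zero_rpow (inv_ne_zero hp0)]

theorem MemW.add {p : ℝ} (hp : 2 ≤ p) {u v : (Fin N → ℤ) → ℝ} (hu : MemW p u) (hv : MemW p v) :
    MemW p (u + v) := by
  have h1 : ∀ x : Fin N → ℤ, (0 : ℝ) ≤ (1 : (Fin N → ℤ) → ℝ) x := fun _ => zero_le_one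
  refine ⟨(wnorm_add hp h1 hu.1 hv.1).1, fun ε hε => ?_⟩
  obtain ⟨φ, hφ, sφ, nφ⟩ := hu.2 (ε / 2) (half_pos hε)
  obtain ⟨ψ, hψ, sψ, nψ⟩ := hv.2 (ε / 2) (half_pos hε)
  have key := wnorm_add hp h1 sφ sψ
  rw [show u - φ + (v - ψ) = u + v - (φ + ψ) by abel] at key
  exact ⟨φ + ψ, (hφ.union hψ).subset (Function.support_add _ _), key.1, by linarith [key.2]⟩

theorem MemW.smul {p : ℝ} (hp : 2 ≤ p) (c : ℝ) {u : (Fin N → ℤ) → ℝ} (hu : MemW p u) :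
    MemW p (c • u) := by
  have h1 : ∀ x : Fin N → ℤ, (0 : ℝ) ≤ (1 : (Fin N → ℤ) → ℝ) x := fun _ => zero_le_one
  refine ⟨summable_smul c hu.1, fun ε hε => ?_⟩
  have hc : 0 < |c| + 1 := by positivity
  obtain ⟨φ, hφ, sφ, nφ⟩ := hu.2 (ε / (|c| + 1)) (div_pos hε hc)
  refine ⟨c • φ, hφ.subset (Function.support_const_smul_subset c φ), ?_, ?_⟩
  · rw [← smul_sub]
    exact summable_smul c sφ
  · rw [← smul_sub, wnorm_smul hp h1]
    have h0 : 0 ≤ wnorm p 1 (u - φ) :=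
      Real.rpow_nonneg (tsum_nonneg (density_nonneg h1 _)) _
    rw [lt_div_iff₀ hc] at nφ
    nlinarith

theorem MemW.zero {p : ℝ} (hp : 2 ≤ p) : MemW p (0 : (Fin N → ℤ) → ℝ) := by
  have s : Summable (density p 1 (0 : (Fin N → ℤ) → ℝ)) := by
    rw [density_zero hp]
    exact summable_zero
  refine ⟨s, fun ε hε => ⟨0, by simp, by simpa using s, ?_⟩⟩
  rw [sub_zero, wnorm_zero hp]
  exact hε

theorem summable_gradNorm {p : ℝ} {u : (Fin N → ℤ) → ℝ} (hu : MemW p u) :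
    Summable fun x => gradNorm u x ^ p :=
  Summable.of_nonneg_of_le (fun _ => Real.rpow_nonneg (gradNorm_nonneg _ _) _)
    (fun _ => le_add_of_nonneg_right
      (mul_nonneg zero_le_one (Real.rpow_nonneg (abs_nonneg _) _))) hu.1

theorem summable_density {p : ℝ} {h u : (Fin N → ℤ) → ℝ} (hu : MemW p u)
    (hs : Summable fun x => h x * |u x| ^ p) : Summable (density p h u) :=
  (summable_gradNorm hu).add hs

theorem summable_weighted {p : ℝ} {h u : (Fin N → ℤ) → ℝ} (hh : ∀ x, 0 ≤ h x)
    (hs : Summable (density p h u)) : Summable fun x => h x * |u x| ^ p :=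
  Summable.of_nonneg_of_le (fun x => mul_nonneg (hh x) (Real.rpow_nonneg (abs_nonneg _) _))
    (fun _ => le_add_of_nonneg_left (Real.rpow_nonneg (gradNorm_nonneg _ _) _)) hs

theorem potential_nonneg {h : (Fin N → ℤ) → ℝ} (h₁ : ∃ h₀ > 0, ∀ x, h₀ ≤ h x) (x) : 0 ≤ h x := by
  obtain ⟨h₀, h0, hx⟩ := h₁
  exact h0.le.trans (hx x)

/-- The linear space `{u ∈ W^{1,p}(ℤ^N) : ∑ h |u|^p < ∞}`. -/
def hSubmodule (p : ℝ) (h : (Fin N → ℤ) → ℝ) (hp : 2 ≤ p) (h₁ : ∃ h₀ > 0, ∀ x, h₀ ≤ h x) :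
    Submodule ℝ ((Fin N → ℤ) → ℝ) where
  carrier := {u | MemW p u ∧ Summable fun x => h x * |u x| ^ p}
  add_mem' {u v} hu hv := ⟨hu.1.add hp hv.1, summable_weighted (potential_nonneg h₁)
    (wnorm_add hp (potential_nonneg h₁) (summable_density hu.1 hu.2)
      (summable_density hv.1 hv.2)).1⟩
  zero_mem' := ⟨MemW.zero hp, by
    have hp0 : p ≠ 0 := by linarith
    simp [Real.zero_rpow hp0, summable_zero]⟩
  smul_mem' c u hu := ⟨hu.1.smul hp c, summable_weighted (potential_nonneg h₁)
    (summable_smul c (summable_density hu.1 hu.2))⟩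

/-- The space `H`, normed by `‖u‖ = (∑ (|∇u|^p + h |u|^p))^(1/p)`. -/
def HSpace (p : ℝ) (h : (Fin N → ℤ) → ℝ) (hp : 2 ≤ p) (h₁ : ∃ h₀ > 0, ∀ x, h₀ ≤ h x) : Type :=
  ↥(hSubmodule p h hp h₁)

variable {p : ℝ} {h : (Fin N → ℤ) → ℝ} {hp : 2 ≤ p} {h₁ : ∃ h₀ > 0, ∀ x, h₀ ≤ h x}

instance : AddCommGroup (HSpace p h hp h₁) := inferInstanceAs (AddCommGroup (hSubmodule p h hp h₁))

instance : Module ℝ (HSpace p h hp h₁) := inferInstanceAs (Module ℝ (hSubmodule p h hp h₁))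

/-- An element of `H` is used as a function on `ℤ^N`. -/
instance : CoeFun (HSpace p h hp h₁) fun _ => (Fin N → ℤ) → ℝ := ⟨fun u => u.1⟩

theorem HSpace.summable (u : HSpace p h hp h₁) : Summable (density p h u) :=
  summable_density u.2.1 u.2.2

theorem HSpace.eq_zero (u : HSpace p h hp h₁) (hu : wnorm p h u = 0) : u = 0 := by
  have hp0 : p ≠ 0 := by linarith
  have nn := density_nonneg (p := p) (potential_nonneg h₁) u
  have h0 : ∑' x, density p h u x = 0 :=
    (Real.rpow_eq_zero (tsum_nonneg nn) (one_div_ne_zero hp0)).1 hu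
  have hd : density p h u = 0 := (hasSum_zero_iff_of_nonneg nn).1 (h0 ▸ u.summable.hasSum)
  refine Subtype.ext (funext fun x => ?_)
  obtain ⟨c, hc, hx⟩ := h₁
  have hx0 : 0 < h x := lt_of_lt_of_le hc (hx x)
  have hdx : gradNorm u x ^ p + h x * |u x| ^ p = 0 := congrFun hd x
  have a : 0 ≤ gradNorm u x ^ p := Real.rpow_nonneg (gradNorm_nonneg _ _) _
  have b : 0 ≤ |u x| ^ p := Real.rpow_nonneg (abs_nonneg _) _
  have hb : |u x| ^ p = 0 := by nlinarith
  exact abs_eq_zero.1 ((Real.rpow_eq_zero (abs_nonneg _) hp0).1 hb)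

instance : NormedAddCommGroup (HSpace p h hp h₁) :=
  AddGroupNorm.toNormedAddCommGroup
    { toFun := fun u => wnorm p h u
      map_zero' := wnorm_zero hp h
      add_le' := fun u v => (wnorm_add hp (potential_nonneg h₁) u.summable v.summable).2
      neg' := fun u => by
        have := wnorm_smul hp (potential_nonneg h₁) (-1) u
        rw [abs_neg, abs_one, one_mul, neg_one_smul] at this
        exact this
      eq_zero_of_map_eq_zero' := fun u hu => u.eq_zero hu }

theorem HSpace.norm_def (u : HSpace p h hp h₁) :
    ‖u‖ = (∑' x, (gradNorm u x ^ p + h x * |u x| ^ p)) ^ (1 / p) := rfl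

instance : NormedSpace ℝ (HSpace p h hp h₁) where
  norm_smul_le c u := le_of_eq (wnorm_smul hp (potential_nonneg h₁) c u)

/-! ### The Green's function of the discrete fractional Laplacian -/

/-- `μ(k) = 2N - 2 ∑ cos k_j`. -/
def symbol (k : Fin N → ℝ) : ℝ := 2 * N - 2 * ∑ j, Real.cos (k j)

/-- The torus `[0, 2π]^N`. -/
def torus (N : ℕ) : Set (Fin N → ℝ) := Set.Icc 0 fun _ => 2 * Real.pi

/-- The fractional degree `K_α`. -/
def fracDegree (N : ℕ) (α : ℝ) : ℝ :=
  1 / (2 * Real.pi) ^ N * ∫ k in torus N, symbol k ^ (α / 2)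

/-- `R_α(x, y)`. The integral is real, by the symmetry `k ↦ 2π - k`, so that taking the real part
only changes the type. -/
def green (α : ℝ) (x y : Fin N → ℤ) : ℝ :=
  (((fracDegree N α / (2 * Real.pi) ^ N : ℝ) : ℂ) *
    ∫ k in torus N, Complex.exp (Complex.I * ((∑ j, ((x j - y j : ℤ) : ℝ) * k j : ℝ) : ℂ)) *
      ((symbol k ^ (-(α / 2)) : ℝ) : ℂ)).re

/-- `(R_α ∗ g)(x) = ∑_y R_α(x, y) g(y)`. -/
def greenConv (α : ℝ) (g : (Fin N → ℤ) → ℝ) (x : Fin N → ℤ) : ℝ := ∑' y, green α x y * g y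

/-! ### The energy, the Nehari manifold and ground states -/

/-- The primitive `F(t) = ∫_0^t f`. -/
def primitive (f : ℝ → ℝ) (t : ℝ) : ℝ := ∫ s in (0 : ℝ)..t, f s

/-- The energy functional `J` on `H`. -/
def energy (α : ℝ) (f : ℝ → ℝ) (u : HSpace p h hp h₁) : ℝ :=
  1 / p * ∑' x, (gradNorm u x ^ p + h x * |u x| ^ p) -
    1 / 2 * ∑' x, greenConv α (fun y => primitive f (u y)) x * primitive f (u x)

/-- The Nehari manifold `{v ∈ H \ {0} : ⟨J'(v), v⟩ = 0}`. -/
def nehari (α : ℝ) (f : ℝ → ℝ) : Set (HSpace p h hp h₁) :=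
  {v | v ≠ 0 ∧ fderiv ℝ (energy α f) v v = 0}

/-- A ground state solution: a nontrivial critical point of `J` at which `J` attains its infimum
over the Nehari manifold. -/
def IsGroundState (α : ℝ) (f : ℝ → ℝ) (u : HSpace p h hp h₁) : Prop :=
  u ≠ 0 ∧ HasFDerivAt (energy α f) (0 : HSpace p h hp h₁ →L[ℝ] ℝ) u ∧
    IsLeast (energy α f '' (nehari α f : Set (HSpace p h hp h₁))) (energy α f u)

end Choquard

end

/-!
The kernel `R_α` is a Gram matrix: `R_α(x, y) = ⟪e x, e y⟫` for weighted plane waves `e x` in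
`L²` of the torus, so that the nonlocal term of `J` is `½ ‖∑ F(u x) e x‖²`. Since `H` embeds into
`ℓ^p ⊆ ℓ^∞`, bounded subsets of `H` have uniformly bounded values, and `J` is of class `C^1`. A
minimizing sequence on the Nehari manifold is bounded because `θ > p`, and it does not tend to zero
uniformly because `f(t) = o(|t|^(p-1))`; translating by periods of `h` one may assume that it tends
pointwise to some `v ≠ 0`. By the Brezis–Lieb lemma the norm and the nonlocal terms split
asymptotically into the contributions of `v` and of the remainder, the cross terms disappearing
because `R_α` decays off the diagonal (Riemann–Lebesgue). The splitting and the monotonicity of the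
fibre maps force `v` onto the Nehari manifold, where it attains the infimum. A minimizer is
critical: were `J'` negative in some direction there, moving a little in this direction and
adjusting along the ray would give a point of the manifold with smaller energy.
-/

noncomputable section

namespace Choquard

/-! ### Families of linear maps into `ℓ^p` -/

section Vanishing

variable {ι Y E : Type*} [TopologicalSpace Y] [NormedAddCommGroup E] [CompleteSpace E]

theorem tendstoLocallyUniformly_tsum_of_vanishing {f : ι → Y → E}
    (hf : ∀ y₀, ∀ ε > 0, ∃ s₀ : Finset ι, ∀ᶠ y in 𝓝 y₀, ∀ s, Disjoint s s₀ →
      ‖∑ i ∈ s, f i y‖ < ε) :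
    TendstoLocallyUniformly (fun (s : Finset ι) y => ∑ i ∈ s, f i y)
      (fun y => ∑' i, f i y) atTop := by
  have hsum : ∀ y, Summable fun i => f i y := fun y =>
    summable_iff_vanishing_norm.2 fun ε hε =>
      (hf y ε hε).imp fun _ h => h.self_of_nhds
  rw [Metric.tendstoLocallyUniformly_iff]
  intro ε hε y₀
  obtain ⟨s₀, h⟩ := hf y₀ (ε / 2) (half_pos hε)
  refine ⟨_, h, ?_⟩
  filter_upwards [eventually_ge_atTop s₀] with s hs y hy
  have hlim : Tendsto (fun t => ‖∑ i ∈ t, f i y - ∑ i ∈ s, f i y‖) atTop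
      (𝓝 ‖∑' i, f i y - ∑ i ∈ s, f i y‖) := ((hsum y).hasSum.sub_const _).norm
  rw [dist_eq_norm]
  refine (le_of_tendsto hlim ?_).trans_lt (half_lt_self hε)
  classical
  filter_upwards [eventually_ge_atTop s] with t ht
  rw [← Finset.sum_sdiff ht, add_sub_cancel_right]
  exact (hy _ (Finset.disjoint_of_subset_right hs Finset.sdiff_disjoint)).le

end Vanishing

section LpBounded

variable {X W ι : Type*} [NormedAddCommGroup X] [NormedSpace ℝ X] [NormedAddCommGroup W]
  [NormedSpace ℝ W] {V : ι → Type*} [∀ i, NormedAddCommGroup (V i)] [∀ i, NormedSpace ℝ (V i)]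
  {p B : ℝ} {L : ∀ i, X →L[ℝ] V i}

/-- The `ℓ^p` norm of the restriction to the finite index set `s` of the family `(L i u)`. -/
def partialNorm (p : ℝ) (L : ∀ i, X →L[ℝ] V i) (s : Finset ι) (u : X) : ℝ :=
  (∑ i ∈ s, ‖L i u‖ ^ p) ^ (1 / p)

/-- `u ↦ (L i u)_i` is a bounded operator of norm at most `B` from `X` to the `ℓ^p` sum of the
spaces `V i`, where `1 < p < ∞`; the bound is stated on finite sums. -/
structure LpBounded (p B : ℝ) (L : ∀ i, X →L[ℝ] V i) : Prop where
  one_lt : 1 < p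
  nonneg : 0 ≤ B
  partialNorm_le : ∀ s u, partialNorm p L s u ≤ B * ‖u‖

theorem partialNorm_nonneg (s : Finset ι) (u : X) : 0 ≤ partialNorm p L s u := by
  unfold partialNorm
  positivity

theorem partialNorm_le_iff (hp : 0 < p) {s : Finset ι} {u : X} {r : ℝ} (hr : 0 ≤ r) :
    partialNorm p L s u ≤ r ↔ ∑ i ∈ s, ‖L i u‖ ^ p ≤ r ^ p := by
  rw [partialNorm, one_div, Real.rpow_inv_le_iff_of_pos (by positivity) hr hp]

theorem partialNorm_add_le (hp : 1 ≤ p) (s : Finset ι) (u v : X) :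
    partialNorm p L s (u + v) ≤ partialNorm p L s u + partialNorm p L s v := by
  refine le_trans ?_ (Real.Lp_add_le_of_nonneg s hp (f := fun i => ‖L i u‖)
    (g := fun i => ‖L i v‖) (fun i _ => norm_nonneg _) (fun i _ => norm_nonneg _))
  unfold partialNorm
  gcongr with i
  rw [map_add]
  exact norm_add_le _ _

/-- Hölder's inequality, in operator form. -/
theorem norm_sum_comp_le_partialNorm (hL : LpBounded p B L) {A : ∀ i, V i →L[ℝ] W} {u : X} {C : ℝ}
    (hC : 0 ≤ C) {s : Finset ι} (hA : ∀ i ∈ s, ‖A i‖ ≤ C * ‖L i u‖ ^ (p - 1)) :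
    ‖∑ i ∈ s, (A i).comp (L i)‖ ≤ C * B * partialNorm p L s u ^ (p - 1) := by
  have hp := hL.one_lt
  have hB := hL.nonneg
  have hu := partialNorm_nonneg (p := p) (L := L) s u
  have hpow : ∀ i, (‖L i u‖ ^ (p - 1)) ^ (p / (p - 1)) = ‖L i u‖ ^ p := fun i => by
    rw [← Real.rpow_mul (norm_nonneg _), mul_div_cancel₀ _ (by linarith)]
  have hroot : (∑ i ∈ s, ‖L i u‖ ^ p) ^ (1 / (p / (p - 1))) = partialNorm p L s u ^ (p - 1) := by
    rw [partialNorm, ← Real.rpow_mul (by positivity), one_div_div, one_div_mul_eq_div]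
  refine ContinuousLinearMap.opNorm_le_bound _ (by positivity) fun v => ?_
  have holder := Real.inner_le_Lp_mul_Lq_of_nonneg s
    (Real.HolderConjugate.conjExponent hp).symm (f := fun i => ‖L i u‖ ^ (p - 1))
    (g := fun i => ‖L i v‖) (fun i _ => by positivity) (fun i _ => norm_nonneg _)
  simp only [Real.conjExponent, hpow, hroot] at holder
  calc ‖(∑ i ∈ s, (A i).comp (L i)) v‖ = ‖∑ i ∈ s, A i (L i v)‖ := by
        simp only [FunLike.coe_sum, Finset.sum_apply, ContinuousLinearMap.comp_apply]
    _ ≤ ∑ i ∈ s, C * (‖L i u‖ ^ (p - 1) * ‖L i v‖) := by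
        refine norm_sum_le_of_le _ fun i hi => ((A i).le_opNorm _).trans ?_
        rw [← mul_assoc]
        exact mul_le_mul_of_nonneg_right (hA i hi) (norm_nonneg _)
    _ = C * ∑ i ∈ s, ‖L i u‖ ^ (p - 1) * ‖L i v‖ := by rw [Finset.mul_sum]
    _ ≤ C * (partialNorm p L s u ^ (p - 1) * (B * ‖v‖)) := by
        refine mul_le_mul_of_nonneg_left (holder.trans ?_) hC
        exact mul_le_mul_of_nonneg_left (hL.partialNorm_le s v) (by positivity)
    _ = _ := by ring

namespace LpBounded

theorem norm_apply_le (hL : LpBounded p B L) (i : ι) (u : X) : ‖L i u‖ ≤ B * ‖u‖ := by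
  have hp := zero_lt_one.trans hL.one_lt
  have hB := hL.nonneg
  have h := (partialNorm_le_iff hp (by positivity)).1 (hL.partialNorm_le {i} u)
  rw [Finset.sum_singleton] at h
  exact (Real.rpow_le_rpow_iff (norm_nonneg _) (by positivity) hp).1 h

theorem sum_rpow_le (hL : LpBounded p B L) (u : X) (s : Finset ι) :
    ∑ i ∈ s, ‖L i u‖ ^ p ≤ (B * ‖u‖) ^ p :=
  (partialNorm_le_iff (zero_lt_one.trans hL.one_lt)
    (mul_nonneg hL.nonneg (norm_nonneg u))).1 (hL.partialNorm_le s u)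

theorem summable_rpow (hL : LpBounded p B L) (u : X) : Summable fun i => ‖L i u‖ ^ p :=
  summable_of_sum_le (fun _ => by positivity) (hL.sum_rpow_le u)

theorem tsum_rpow_le (hL : LpBounded p B L) (u : X) : ∑' i, ‖L i u‖ ^ p ≤ (B * ‖u‖) ^ p :=
  (hL.summable_rpow u).tsum_le_of_sum_le (hL.sum_rpow_le u)

theorem exists_partialNorm_lt (hL : LpBounded p B L) (u₀ : X) {ε : ℝ} (hε : 0 < ε) :
    ∃ s₀ : Finset ι, ∀ᶠ u in 𝓝 u₀, ∀ s, Disjoint s s₀ → partialNorm p L s u < ε := by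
  have hp := zero_lt_one.trans hL.one_lt
  obtain ⟨s₀, hs₀⟩ := summable_iff_vanishing_norm.1 (hL.summable_rpow u₀) ((ε / 2) ^ p)
    (by positivity)
  have hclose : ∀ᶠ u in 𝓝 u₀, B * ‖u - u₀‖ < ε / 2 := by
    have hcont : ContinuousAt (fun u => B * ‖u - u₀‖) u₀ := by fun_prop
    exact hcont.eventually_lt_const (by simpa using half_pos hε)
  refine ⟨s₀, hclose.mono fun u hu s hs => ?_⟩
  have htail : partialNorm p L s u₀ ≤ ε / 2 :=
    (partialNorm_le_iff hp (by positivity)).2 ((Real.le_norm_self _).trans (hs₀ s hs).le)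
  calc partialNorm p L s u = partialNorm p L s (u₀ + (u - u₀)) := by rw [add_sub_cancel]
    _ ≤ partialNorm p L s u₀ + partialNorm p L s (u - u₀) := partialNorm_add_le hL.one_lt.le ..
    _ < ε := by linarith [hL.partialNorm_le s (u - u₀)]

end LpBounded

/-- `‖g i v‖ = O(‖v‖ ^ r)` on bounded sets, uniformly in `i`. -/
def LocallyGrowsLike (r : ℝ) {Z : ι → Type*} [∀ i, Norm (Z i)] (g : ∀ i, V i → Z i) : Prop :=
  ∀ M, ∃ C, 0 ≤ C ∧ ∀ i v, ‖v‖ ≤ M → ‖g i v‖ ≤ C * ‖v‖ ^ r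

/-- The series `∑ g' i (L i u) ∘ L i`, the derivative at `u` of `u ↦ ∑ g i (L i u)`. -/
def tsumComp (L : ∀ i, X →L[ℝ] V i) (g' : ∀ i, V i → V i →L[ℝ] W) (u : X) : X →L[ℝ] W :=
  ∑' i, (g' i (L i u)).comp (L i)

namespace LpBounded

theorem summable_norm_comp_of_growth {E : Type*} [NormedAddCommGroup E] (hL : LpBounded p B L)
    {g : ∀ i, V i → E} (hg : LocallyGrowsLike p g) (u : X) :
    Summable fun i => ‖g i (L i u)‖ := by
  obtain ⟨C, -, hC⟩ := hg (B * ‖u‖)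
  exact ((hL.summable_rpow u).mul_left C).of_nonneg_of_le (fun _ => norm_nonneg _)
    fun i => hC i _ (hL.norm_apply_le i u)

theorem exists_tsum_norm_comp_le {E : Type*} [NormedAddCommGroup E] (hL : LpBounded p B L)
    {g : ∀ i, V i → E} (hg : LocallyGrowsLike p g) (M : ℝ) :
    ∃ C, ∀ u, ‖u‖ ≤ M → ∑' i, ‖g i (L i u)‖ ≤ C := by
  have hp := zero_lt_one.trans hL.one_lt
  have hB := hL.nonneg
  obtain ⟨C, hC₀, hC⟩ := hg (B * M)
  refine ⟨C * (B * M) ^ p, fun u hu => ?_⟩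
  calc ∑' i, ‖g i (L i u)‖ ≤ ∑' i, C * ‖L i u‖ ^ p :=
        (hL.summable_norm_comp_of_growth hg u).tsum_le_tsum
          (fun i => hC i _ ((hL.norm_apply_le i u).trans (by gcongr)))
          ((hL.summable_rpow u).mul_left C)
    _ = C * ∑' i, ‖L i u‖ ^ p := tsum_mul_left
    _ ≤ C * (B * ‖u‖) ^ p := by gcongr; exact hL.tsum_rpow_le u
    _ ≤ C * (B * M) ^ p := by gcongr

variable {g' : ∀ i, V i → V i →L[ℝ] W}

theorem exists_norm_sum_comp_lt (hL : LpBounded p B L) (hg' : LocallyGrowsLike (p - 1) g')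
    (u₀ : X) {ε : ℝ} (hε : 0 < ε) :
    ∃ s₀ : Finset ι, ∀ᶠ u in 𝓝 u₀, ∀ s, Disjoint s s₀ →
      ‖∑ i ∈ s, (g' i (L i u)).comp (L i)‖ < ε := by
  obtain ⟨C, hC₀, hC⟩ := hg' (B * (‖u₀‖ + 1))
  have hlim : ContinuousAt (fun r : ℝ => C * B * r ^ (p - 1)) 0 :=
    continuousAt_const.mul (continuousAt_id.rpow_const (Or.inr (by linarith [hL.one_lt])))
  have hzero : C * B * (0 : ℝ) ^ (p - 1) < ε := by
    rwa [Real.zero_rpow (by linarith [hL.one_lt]), mul_zero]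
  obtain ⟨η, hη, hηε⟩ := Metric.eventually_nhds_iff.1 (hlim.eventually_lt_const hzero)
  obtain ⟨s₀, hs₀⟩ := hL.exists_partialNorm_lt u₀ hη
  have hbdd : ∀ᶠ u in 𝓝 u₀, ‖u‖ < ‖u₀‖ + 1 :=
    continuous_norm.continuousAt.eventually_lt_const (lt_add_one _)
  refine ⟨s₀, (hs₀.and hbdd).mono fun u hu s hs => ?_⟩
  refine (norm_sum_comp_le_partialNorm hL hC₀ (u := u) fun i _ => hC i _ ?_).trans_lt (hηε ?_)
  · exact (hL.norm_apply_le i u).trans (mul_le_mul_of_nonneg_left hu.2.le hL.nonneg)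
  · rw [dist_zero_right, Real.norm_of_nonneg (partialNorm_nonneg s u)]
    exact hu.1 s hs

variable [CompleteSpace W]

theorem tendstoLocallyUniformly_sum_comp (hL : LpBounded p B L)
    (hg' : LocallyGrowsLike (p - 1) g') :
    TendstoLocallyUniformly (fun (s : Finset ι) u => ∑ i ∈ s, (g' i (L i u)).comp (L i))
      (tsumComp L g') atTop :=
  tendstoLocallyUniformly_tsum_of_vanishing (f := fun i u => (g' i (L i u)).comp (L i))
    fun u _ hε => hL.exists_norm_sum_comp_lt hg' u hε

theorem hasSum_tsumComp_apply (hL : LpBounded p B L) (hg' : LocallyGrowsLike (p - 1) g')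
    (u v : X) : HasSum (fun i => g' i (L i u) (L i v)) (tsumComp L g' u v) := by
  have hsum : Summable fun i => (g' i (L i u)).comp (L i) :=
    summable_iff_vanishing_norm.2 fun ε hε =>
      (hL.exists_norm_sum_comp_lt hg' u hε).imp fun _ h => h.self_of_nhds
  have h := (ContinuousLinearMap.apply ℝ W v).hasSum hsum.hasSum
  simpa only [tsumComp, ContinuousLinearMap.apply_apply, ContinuousLinearMap.comp_apply] using h

theorem continuous_tsumComp (hL : LpBounded p B L) (hg' : LocallyGrowsLike (p - 1) g')
    (hcont : ∀ i, Continuous (g' i)) : Continuous (tsumComp L g') :=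
  (hL.tendstoLocallyUniformly_sum_comp hg').continuous <| Frequently.of_forall fun _ =>
    continuous_finsetSum _ fun i _ => ((hcont i).comp (L i).continuous).clm_comp continuous_const

theorem hasFDerivAt_tsum_comp (hL : LpBounded p B L) {g : ∀ i, V i → W}
    (hg : LocallyGrowsLike p g) (hg' : LocallyGrowsLike (p - 1) g')
    (hderiv : ∀ i v, HasFDerivAt (g i) (g' i v) v) (u : X) :
    HasFDerivAt (fun u => ∑' i, g i (L i u)) (tsumComp L g' u) u :=
  hasFDerivAt_of_tendstoLocallyUniformlyOn isOpen_univ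
    (tendstoLocallyUniformlyOn_univ.2 (hL.tendstoLocallyUniformly_sum_comp hg'))
    (fun _ u _ => HasFDerivAt.fun_sum fun i _ => (hderiv i _).comp u (L i).hasFDerivAt)
    (fun u _ => (hL.summable_norm_comp_of_growth hg u).of_norm.hasSum) (Set.mem_univ u)

end LpBounded

end LpBounded

section PowerSum

variable {X ι : Type*} [NormedAddCommGroup X] [NormedSpace ℝ X] {V : ι → Type*}
  [∀ i, NormedAddCommGroup (V i)] [∀ i, InnerProductSpace ℝ (V i)] {p B : ℝ}
  {L : ∀ i, X →L[ℝ] V i}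

/-- The derivative of `u ↦ ∑ ‖L i u‖ ^ p` at `u`. -/
def tsumRpowDeriv (p : ℝ) (L : ∀ i, X →L[ℝ] V i) (u : X) : X →L[ℝ] ℝ :=
  tsumComp L (fun i => fderiv ℝ fun v : V i => ‖v‖ ^ p) u

theorem locallyGrowsLike_fderiv_norm_rpow (hp : 1 < p) :
    LocallyGrowsLike (p - 1) fun i => fderiv ℝ fun v : V i => ‖v‖ ^ p :=
  fun _ => ⟨p, by linarith, fun _ v _ => (norm_fderiv_norm_id_rpow v hp).le⟩

namespace LpBounded

theorem continuous_tsumRpowDeriv (hL : LpBounded p B L) : Continuous (tsumRpowDeriv p L) :=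
  hL.continuous_tsumComp (locallyGrowsLike_fderiv_norm_rpow hL.one_lt) fun _ =>
    (contDiff_norm_rpow hL.one_lt).continuous_fderiv one_ne_zero

theorem hasFDerivAt_tsum_rpow (hL : LpBounded p B L) (u : X) :
    HasFDerivAt (fun u => ∑' i, ‖L i u‖ ^ p) (tsumRpowDeriv p L u) u := by
  refine hL.hasFDerivAt_tsum_comp (g := fun i (v : V i) => ‖v‖ ^ p) (fun _ => ⟨1, zero_le_one,
    fun i v _ => ?_⟩) (locallyGrowsLike_fderiv_norm_rpow hL.one_lt) (fun i v => ?_) u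
  · rw [Real.norm_of_nonneg (by positivity), one_mul]
  · exact ((contDiff_norm_rpow hL.one_lt).differentiable one_ne_zero v).hasFDerivAt

theorem hasSum_tsumRpowDeriv_apply (hL : LpBounded p B L) (u v : X) :
    HasSum (fun i => p * ‖L i u‖ ^ (p - 2) * inner ℝ (L i u) (L i v)) (tsumRpowDeriv p L u v) := by
  have h := hL.hasSum_tsumComp_apply (locallyGrowsLike_fderiv_norm_rpow (V := V) hL.one_lt) u v
  simpa only [tsumRpowDeriv, fderiv_norm_rpow _ hL.one_lt, FunLike.coe_smul, Pi.smul_apply,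
    smul_eq_mul, innerSL_apply_apply] using h

theorem tsumRpowDeriv_apply_self (hL : LpBounded p B L) (u : X) :
    tsumRpowDeriv p L u u = p * ∑' i, ‖L i u‖ ^ p := by
  rw [← (hL.hasSum_tsumRpowDeriv_apply u u).tsum_eq, ← tsum_mul_left]
  refine tsum_congr fun i => ?_
  rw [real_inner_self_eq_norm_sq, mul_assoc]
  rcases eq_or_ne (L i u) 0 with h | h
  · simp [h, Real.zero_rpow (by linarith [hL.one_lt] : p ≠ 0)]
  · rw [← Real.rpow_two, ← Real.rpow_add (norm_pos_iff.2 h), sub_add_cancel]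

end LpBounded

end PowerSum

/-! ### The Brezis–Lieb lemma -/

section AlmostDominated

variable {ι β : Type*} {l : Filter β}

theorem tendsto_tsum_zero_of_almost_dominated {d m : β → ι → ℝ} (hd : ∀ n i, 0 ≤ d n i)
    (hd₀ : ∀ i, Tendsto (fun n => d n i) l (𝓝 0)) (hm : ∀ n i, 0 ≤ m n i)
    (hsum : ∀ n, Summable (m n)) {M : ℝ} (hM : ∀ n, ∑' i, m n i ≤ M)
    (hle : ∀ ε > 0, ∃ b : ι → ℝ, Summable b ∧ ∀ n i, d n i ≤ ε * m n i + b i) :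
    Tendsto (fun n => ∑' i, d n i) l (𝓝 0) := by
  refine Metric.tendsto_nhds.2 fun ε hε => ?_
  have hη : 0 < ε / (2 * (|M| + 1)) := by positivity
  obtain ⟨b, hb, hdb⟩ := hle _ hη
  set η := ε / (2 * (|M| + 1)) with hη_def
  have hηM : η * M < ε / 2 := by
    have : η * (|M| + 1) = ε / 2 := by rw [hη_def]; field_simp
    nlinarith [le_abs_self M]
  have hexcess : ∀ n i, ‖max (d n i - η * m n i) 0‖ ≤ |b i| := fun n i => by
    rw [Real.norm_of_nonneg (le_max_right _ _)]
    exact max_le (by linarith [hdb n i, le_abs_self (b i)]) (abs_nonneg _)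
  have hlim : Tendsto (fun n => ∑' i, max (d n i - η * m n i) 0) l (𝓝 (∑' _ : ι, (0 : ℝ))) := by
    refine tendsto_tsum_of_dominated_convergence hb.abs (fun i => ?_) (.of_forall hexcess)
    refine squeeze_zero (fun n => le_max_right _ _) (fun n => ?_) (hd₀ i)
    exact max_le (by linarith [mul_nonneg hη.le (hm n i)]) (hd n i)
  rw [tsum_zero] at hlim
  filter_upwards [hlim.eventually_lt_const (half_pos hε)] with n hn
  have hs : Summable fun i => max (d n i - η * m n i) 0 := .of_norm_bounded hb.abs (hexcess n)
  have hs' := hs.add ((hsum n).mul_left η)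
  have hsplit : ∀ i, d n i ≤ max (d n i - η * m n i) 0 + η * m n i := fun i => by
    linarith [le_max_left (d n i - η * m n i) 0]
  rw [dist_zero_right, Real.norm_of_nonneg (tsum_nonneg (hd n))]
  calc ∑' i, d n i ≤ ∑' i, (max (d n i - η * m n i) 0 + η * m n i) :=
        (hs'.of_nonneg_of_le (hd n) hsplit).tsum_le_tsum hsplit hs'
    _ = ∑' i, max (d n i - η * m n i) 0 + η * ∑' i, m n i := by
        rw [hs.tsum_add ((hsum n).mul_left η), tsum_mul_left]
    _ < ε := by linarith [mul_le_mul_of_nonneg_left (hM n) hη.le]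

theorem tendsto_tsum_mul_zero {a : β → ι → ℝ} {b : ι → ℝ} {C : ℝ}
    (ha : ∀ n, Summable fun i => |a n i|) (haC : ∀ n, ∑' i, |a n i| ≤ C)
    (ha₀ : ∀ i, Tendsto (fun n => a n i) l (𝓝 0)) (hb : Tendsto b cofinite (𝓝 0)) :
    Tendsto (fun n => ∑' i, a n i * b i) l (𝓝 0) := by
  have hle : ∀ ε > 0, ∃ c : ι → ℝ, Summable c ∧ ∀ n i, |a n i * b i| ≤ ε * |a n i| + c i := by
    intro ε hε
    have hfin : {i | ¬ |b i| ≤ ε}.Finite := by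
      have := hb.abs
      rw [abs_zero] at this
      exact this.eventually_le_const hε
    refine ⟨Set.indicator {i | ¬ |b i| ≤ ε} fun i => C * |b i|,
      summable_of_hasFiniteSupport (hfin.subset Set.support_indicator_subset), fun n i => ?_⟩
    rw [abs_mul]
    by_cases hi : |b i| ≤ ε
    · rw [Set.indicator_of_notMem (by simpa using hi), add_zero, mul_comm]
      exact mul_le_mul_of_nonneg_right hi (abs_nonneg _)
    · rw [Set.indicator_of_mem (by simpa using hi)]
      have : |a n i| ≤ C := ((ha n).le_tsum i fun _ _ => abs_nonneg _).trans (haC n)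
      nlinarith [abs_nonneg (a n i), abs_nonneg (b i)]
  have hlim := tendsto_tsum_zero_of_almost_dominated (d := fun n i => |a n i * b i|)
    (fun _ _ => abs_nonneg _) (fun i => by simpa using ((ha₀ i).mul_const (b i)).abs)
    (fun _ _ => abs_nonneg _) ha haC hle
  obtain ⟨c, hc, hac⟩ := hle 1 one_pos
  refine squeeze_zero_norm (fun n => norm_tsum_le_tsum_norm ?_) hlim
  exact (((ha n).mul_left 1).add hc).of_nonneg_of_le (fun _ => norm_nonneg _) (hac n)

end AlmostDominated

section RpowIncrement

theorem exists_rpow_near_one {p ε : ℝ} (hp : 0 < p) (hε : 0 < ε) :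
    ∃ κ : ℝ, 0 < κ ∧ κ < 1 ∧ (1 + κ) ^ p < 1 + ε ∧ 1 - ε < (1 - κ) ^ p := by
  have hadd : ContinuousAt (fun κ : ℝ => (1 + κ) ^ p) 0 :=
    (continuousAt_const.add continuousAt_id).rpow_const (Or.inr hp.le)
  have hsub : ContinuousAt (fun κ : ℝ => (1 - κ) ^ p) 0 :=
    (continuousAt_const.sub continuousAt_id).rpow_const (Or.inr hp.le)
  have hev : ∀ᶠ κ : ℝ in 𝓝 0, κ < 1 ∧ (1 + κ) ^ p < 1 + ε ∧ 1 - ε < (1 - κ) ^ p :=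
    (eventually_lt_nhds zero_lt_one).and
      ((hadd.eventually_lt_const (by simpa using hε)).and
        (hsub.eventually_const_lt (by simpa using hε)))
  obtain ⟨κ, h, hκ⟩ := ((hev.filter_mono nhdsWithin_le_nhds).and
    (self_mem_nhdsWithin (s := Set.Ioi (0 : ℝ)))).exists
  exact ⟨κ, hκ, h⟩

theorem exists_abs_rpow_sub_rpow_le {p ε : ℝ} (hp : 0 < p) (hε : 0 < ε) :
    ∃ C, 0 ≤ C ∧ ∀ a b d : ℝ, 0 ≤ a → 0 ≤ b → |a - b| ≤ d →
      |a ^ p - b ^ p| ≤ ε * b ^ p + C * d ^ p := by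
  obtain ⟨κ, hκ₀, hκ₁, hadd, hsub⟩ := exists_rpow_near_one hp hε
  refine ⟨(κ⁻¹ + 1) ^ p, by positivity, fun a b d ha hb hd => ?_⟩
  have hd₀ : 0 ≤ d := (abs_nonneg _).trans hd
  obtain ⟨hd₁, hd₂⟩ := abs_le.1 hd
  rcases le_or_gt d (κ * b) with hdb | hdb
  · have hupper : a ^ p ≤ (1 + ε) * b ^ p := by
      calc a ^ p ≤ ((1 + κ) * b) ^ p := Real.rpow_le_rpow ha (by linarith) hp.le
        _ = (1 + κ) ^ p * b ^ p := Real.mul_rpow (by linarith) hb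
        _ ≤ _ := by gcongr
    have hlower : (1 - ε) * b ^ p ≤ a ^ p := by
      calc (1 - ε) * b ^ p ≤ (1 - κ) ^ p * b ^ p := by gcongr
        _ = ((1 - κ) * b) ^ p := (Real.mul_rpow (by linarith) hb).symm
        _ ≤ a ^ p := Real.rpow_le_rpow (mul_nonneg (by linarith) hb) (by linarith) hp.le
    have : 0 ≤ (κ⁻¹ + 1) ^ p * d ^ p := by positivity
    exact abs_le.2 ⟨by linarith, by linarith⟩
  · have hb' : b ≤ κ⁻¹ * d := by
      rw [inv_mul_eq_div, le_div_iff₀ hκ₀]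
      linarith
    have hpow : ∀ c, 0 ≤ c → c ≤ (κ⁻¹ + 1) * d → c ^ p ≤ (κ⁻¹ + 1) ^ p * d ^ p := fun c hc h => by
      rw [← Real.mul_rpow (by positivity) hd₀]
      exact Real.rpow_le_rpow hc h hp.le
    have ha_le := hpow a ha (by linarith)
    have hb_le := hpow b hb (by linarith)
    have ha_nonneg : 0 ≤ a ^ p := by positivity
    have hb_nonneg : 0 ≤ b ^ p := by positivity
    have : 0 ≤ ε * b ^ p := by positivity
    exact abs_le.2 ⟨by linarith, by linarith⟩

end RpowIncrement

section BrezisLieb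

variable {ι : Type*} {V : ι → Type*} [∀ i, NormedAddCommGroup (V i)]
  {E : Type*} [NormedAddCommGroup E] {p : ℝ} {g : ∀ i, V i → E}

/-- The conditions on a family of functions `g i`, uniform in `i`, under which the series
`∑ g i (u i)` splits as in the Brezis–Lieb lemma along bounded sequences of `ℓ^p`. -/
structure BrezisLieb (p : ℝ) (g : ∀ i, V i → E) : Prop where
  continuous : ∀ i, Continuous (g i)
  map_zero : ∀ i, g i 0 = 0
  norm_sub_le : ∀ M, ∀ ε > 0, ∃ C, 0 ≤ C ∧ ∀ i a b, ‖a‖ ≤ M → ‖b‖ ≤ M →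
    ‖g i a - g i b‖ ≤ ε * (‖a‖ ^ p + ‖b‖ ^ p) + C * ‖a - b‖ ^ p

theorem BrezisLieb.locallyGrowsLike (hg : BrezisLieb p g) (hp : 0 < p) :
    LocallyGrowsLike p g := by
  intro M
  obtain ⟨C, hC₀, hC⟩ := hg.norm_sub_le M 1 one_pos
  refine ⟨1 + C, by positivity, fun i v hv => ?_⟩
  have h := hC i v 0 hv (by simpa using (norm_nonneg v).trans hv)
  rw [hg.map_zero, sub_zero, sub_zero, norm_zero, Real.zero_rpow hp.ne'] at h
  linarith

theorem brezisLieb_norm_rpow (hp : 0 < p) : BrezisLieb p fun i (v : V i) => ‖v‖ ^ p where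
  continuous i := continuous_norm.rpow_const fun _ => Or.inr hp.le
  map_zero i := by rw [norm_zero, Real.zero_rpow hp.ne']
  norm_sub_le M ε hε := by
    obtain ⟨C, hC₀, hC⟩ := exists_abs_rpow_sub_rpow_le hp hε
    refine ⟨C, hC₀, fun i a b _ _ => (hC _ _ _ (norm_nonneg a) (norm_nonneg b)
      (abs_norm_sub_norm_le a b)).trans ?_⟩
    gcongr
    exact le_add_of_nonneg_left (by positivity)

variable {X β : Type*} [NormedAddCommGroup X] [NormedSpace ℝ X] [∀ i, NormedSpace ℝ (V i)]
  {B : ℝ} {L : ∀ i, X →L[ℝ] V i} {l : Filter β} {u : β → X} {v : X} {M : ℝ}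

theorem LpBounded.tendsto_tsum_norm_sub_sub (hL : LpBounded p B L) (hg : BrezisLieb p g)
    (hM : ∀ n, ‖u n‖ ≤ M) (hlim : ∀ i, Tendsto (fun n => L i (u n)) l (𝓝 (L i v))) :
    Tendsto (fun n => ∑' i, ‖g i (L i (u n)) - g i (L i (u n - v)) - g i (L i v)‖) l (𝓝 0) := by
  have hp := zero_lt_one.trans hL.one_lt
  have hB := hL.nonneg
  have hnorm : ∀ n, ‖u n‖ ≤ M + ‖v‖ ∧ ‖u n - v‖ ≤ M + ‖v‖ := fun n =>
    ⟨by linarith [hM n, norm_nonneg v], by linarith [norm_sub_le (u n) v, hM n]⟩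
  obtain ⟨Cv, -, hCv⟩ := hg.locallyGrowsLike hp (B * ‖v‖)
  refine tendsto_tsum_zero_of_almost_dominated (fun _ _ => norm_nonneg _) (fun i => ?_)
    (m := fun n i => ‖L i (u n)‖ ^ p + ‖L i (u n - v)‖ ^ p) (fun _ _ => by positivity)
    (fun n => (hL.summable_rpow _).add (hL.summable_rpow _))
    (M := (B * (M + ‖v‖)) ^ p + (B * (M + ‖v‖)) ^ p) (fun n => ?_) fun ε hε => ?_
  · have hsub : Tendsto (fun n => L i (u n - v)) l (𝓝 0) := by
      simpa using (hlim i).sub_const (L i v)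
    have h := (((((hg.continuous i).tendsto _).comp (hlim i)).sub
      (((hg.continuous i).tendsto _).comp hsub)).sub_const (g i (L i v))).norm
    simpa [hg.map_zero] using h
  · rw [(hL.summable_rpow _).tsum_add (hL.summable_rpow _)]
    obtain ⟨h₁, h₂⟩ := hnorm n
    gcongr
    · exact (hL.tsum_rpow_le _).trans (by gcongr)
    · exact (hL.tsum_rpow_le _).trans (by gcongr)
  · obtain ⟨C, -, hC⟩ := hg.norm_sub_le (B * (M + ‖v‖)) ε hε
    refine ⟨fun i => (C + Cv) * ‖L i v‖ ^ p, (hL.summable_rpow v).mul_left _, fun n i => ?_⟩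
    have hle : ∀ w : X, ‖w‖ ≤ M + ‖v‖ → ‖L i w‖ ≤ B * (M + ‖v‖) := fun w hw =>
      (hL.norm_apply_le i w).trans (mul_le_mul_of_nonneg_left hw hB)
    have hdiff := hC i _ _ (hle _ (hnorm n).1) (hle _ (hnorm n).2)
    rw [← map_sub, sub_sub_cancel] at hdiff
    linarith [norm_sub_le (g i (L i (u n)) - g i (L i (u n - v))) (g i (L i v)),
      hCv i _ (hL.norm_apply_le i v)]

theorem LpBounded.tendsto_tsum_sub_tsum [CompleteSpace E] (hL : LpBounded p B L)
    (hg : BrezisLieb p g) (hM : ∀ n, ‖u n‖ ≤ M)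
    (hlim : ∀ i, Tendsto (fun n => L i (u n)) l (𝓝 (L i v))) :
    Tendsto (fun n => ∑' i, g i (L i (u n)) - ∑' i, g i (L i (u n - v))) l
      (𝓝 (∑' i, g i (L i v))) := by
  rw [tendsto_iff_norm_sub_tendsto_zero]
  refine squeeze_zero (fun _ => norm_nonneg _) (fun n => ?_)
    (hL.tendsto_tsum_norm_sub_sub hg hM hlim)
  have hgrowth := hg.locallyGrowsLike (zero_lt_one.trans hL.one_lt)
  have hs := fun w : X => hL.summable_norm_comp_of_growth hgrowth w
  rw [← (hs (u n)).of_norm.tsum_sub (hs (u n - v)).of_norm,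
    ← ((hs (u n)).of_norm.sub (hs (u n - v)).of_norm).tsum_sub (hs v).of_norm]
  refine norm_tsum_le_tsum_norm ((((hs (u n)).add (hs (u n - v))).add (hs v)).of_nonneg_of_le
    (fun _ => norm_nonneg _) fun i => ?_)
  exact (norm_sub_le _ _).trans (add_le_add_left (norm_sub_le _ _) _)

end BrezisLieb

/-! ### Nonlinearities of order `o(|t|^p)` at the origin -/

/-- `k` is continuous and `o(|t|^p)` as `t → 0`, the point `t = 0` included. -/
structure IsSmallPow (p : ℝ) (k : ℝ → ℝ) : Prop where
  continuous : Continuous k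
  isLittleO : k =o[𝓝 0] fun t => |t| ^ p

theorem isSmallPow_of_isLittleO_punctured {q : ℝ} (hq : 0 < q) {f : ℝ → ℝ} (hf : Continuous f)
    (ho : f =o[𝓝[≠] 0] fun t => |t| ^ q) : IsSmallPow q f := by
  have hpow : Tendsto (fun t : ℝ => |t| ^ q) (𝓝[≠] 0) (𝓝 0) := by
    have h := (continuous_abs.rpow_const fun _ => Or.inr hq.le).tendsto (0 : ℝ)
    rw [abs_zero, Real.zero_rpow hq.ne'] at h
    exact h.mono_left nhdsWithin_le_nhds
  have hf₀ : f 0 = 0 := tendsto_nhds_unique ((hf.tendsto 0).mono_left nhdsWithin_le_nhds)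
    (ho.isBigO.trans_tendsto hpow)
  refine ⟨hf, ?_⟩
  rw [← nhdsNE_sup_pure]
  exact ho.sup (Asymptotics.isLittleO_pure.2 hf₀)

theorem hasDerivAt_primitive {f : ℝ → ℝ} (hf : Continuous f) (t : ℝ) :
    HasDerivAt (primitive f) (f t) t :=
  intervalIntegral.integral_hasDerivAt_right (hf.intervalIntegrable _ _)
    (hf.stronglyMeasurableAtFilter _ _) hf.continuousAt

namespace IsSmallPow

variable {p : ℝ} {k f : ℝ → ℝ}

theorem exists_abs_le (hk : IsSmallPow p k) {ε : ℝ} (hε : 0 < ε) :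
    ∃ δ > 0, ∀ t, |t| ≤ δ → |k t| ≤ ε * |t| ^ p := by
  obtain ⟨δ, hδ, h⟩ := Metric.nhds_basis_closedBall.eventually_iff.1 (hk.isLittleO.def hε)
  refine ⟨δ, hδ, fun t ht => ?_⟩
  have := h (mem_closedBall_zero_iff.2 ht)
  rwa [Real.norm_eq_abs, Real.norm_of_nonneg (by positivity)] at this

theorem apply_zero (hk : IsSmallPow p k) (hp : 0 < p) : k 0 = 0 := by
  obtain ⟨δ, hδ, h⟩ := hk.exists_abs_le one_pos
  simpa [Real.zero_rpow hp.ne'] using h 0 (by simpa using hδ.le)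

theorem mul_id (hp : 1 < p) (hf : IsSmallPow (p - 1) f) : IsSmallPow p fun t => f t * t where
  continuous := hf.continuous.mul continuous_id
  isLittleO := by
    refine (hf.isLittleO.mul_isBigO (Asymptotics.isBigO_refl _ _).abs_right).congr_right
      fun t => ?_
    rw [← Real.rpow_add_one' (abs_nonneg t) (by linarith), sub_add_cancel]

theorem primitive (hp : 1 < p) (hf : IsSmallPow (p - 1) f) :
    IsSmallPow p (primitive f) where
  continuous := continuous_iff_continuousAt.2 fun t =>
    (hasDerivAt_primitive hf.continuous t).continuousAt
  isLittleO := by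
    refine Asymptotics.isLittleO_iff.2 fun ε hε => ?_
    obtain ⟨δ, hδ, h⟩ := hf.exists_abs_le hε
    refine Metric.nhds_basis_closedBall.eventually_iff.2 ⟨δ, hδ, fun t ht => ?_⟩
    have hbound : ∀ s ∈ Set.uIoc 0 t, ‖f s‖ ≤ ε * |t| ^ (p - 1) := fun s hs => by
      have hst : |s| ≤ |t| := by
        simpa using Set.abs_sub_left_of_mem_uIcc (Set.uIoc_subset_uIcc hs)
      exact (h s (hst.trans (mem_closedBall_zero_iff.1 ht))).trans <| mul_le_mul_of_nonneg_left
        (Real.rpow_le_rpow (abs_nonneg s) hst (by linarith)) hε.le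
    calc ‖Choquard.primitive f t‖ ≤ ε * |t| ^ (p - 1) * |t - 0| :=
          intervalIntegral.norm_integral_le_of_norm_le_const hbound
      _ = ε * ‖|t| ^ p‖ := by
          rw [sub_zero, mul_assoc, ← Real.rpow_add_one' (abs_nonneg t) (by linarith),
            sub_add_cancel, Real.norm_of_nonneg (by positivity)]

theorem exists_abs_sub_le (hk : IsSmallPow p k) (hp : 0 ≤ p) (M : ℝ) {ε : ℝ} (hε : 0 < ε) :
    ∃ C, 0 ≤ C ∧ ∀ a b, |a| ≤ M → |b| ≤ M →
      |k a - k b| ≤ ε * (|a| ^ p + |b| ^ p) + C * |a - b| ^ p := by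
  obtain ⟨δ, hδ, hsmall⟩ := hk.exists_abs_le hε
  obtain ⟨K, hK⟩ := (isCompact_Icc (a := -M) (b := M)).exists_bound_of_continuousOn
    hk.continuous.continuousOn
  obtain ⟨κ, hκ, hκ'⟩ := Metric.uniformContinuousOn_iff.1
    ((isCompact_Icc (a := -M) (b := M)).uniformContinuousOn_of_continuous
      hk.continuous.continuousOn) (ε * δ ^ p) (by positivity)
  refine ⟨2 * |K| / κ ^ p, by positivity, fun a b ha hb => ?_⟩
  have hC : 0 ≤ 2 * |K| / κ ^ p * |a - b| ^ p := by positivity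
  have hsub := abs_sub (k a) (k b)
  by_cases hab : |a| ≤ δ ∧ |b| ≤ δ
  · linarith [hsmall a hab.1, hsmall b hab.2]
  have hδp : δ ^ p ≤ |a| ^ p + |b| ^ p := by
    rcases not_and_or.1 hab with h | h
    · exact (Real.rpow_le_rpow hδ.le (not_le.1 h).le hp).trans
        (le_add_of_nonneg_right (by positivity))
    · exact (Real.rpow_le_rpow hδ.le (not_le.1 h).le hp).trans
        (le_add_of_nonneg_left (by positivity))
  rcases lt_or_ge |a - b| κ with h | h
  · have huc := (hκ' a (abs_le.1 ha) b (abs_le.1 hb) h).le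
    rw [Real.dist_eq] at huc
    linarith [mul_le_mul_of_nonneg_left hδp hε.le]
  · have hka := (hK a (abs_le.1 ha)).trans (le_abs_self K)
    have hkb := (hK b (abs_le.1 hb)).trans (le_abs_self K)
    rw [Real.norm_eq_abs] at hka hkb
    have hfar : 2 * |K| ≤ 2 * |K| / κ ^ p * |a - b| ^ p := by
      calc 2 * |K| = 2 * |K| / κ ^ p * κ ^ p := by rw [div_mul_cancel₀ _ (by positivity)]
        _ ≤ _ := by gcongr
    have : 0 ≤ ε * (|a| ^ p + |b| ^ p) := by positivity
    linarith

theorem brezisLieb {ι V : Type*} [NormedAddCommGroup V] [NormedSpace ℝ V] (hk : IsSmallPow p k)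
    (hp : 0 < p) {e : ι → V} {D : ℝ} (he : ∀ i, ‖e i‖ ≤ D) :
    BrezisLieb p fun i (t : ℝ) => k t • e i where
  continuous i := hk.continuous.smul continuous_const
  map_zero i := by rw [hk.apply_zero hp, zero_smul]
  norm_sub_le M ε hε := by
    obtain ⟨C, hC₀, hC⟩ := hk.exists_abs_sub_le hp.le M (div_pos hε (by positivity : 0 < |D| + 1))
    refine ⟨C * (|D| + 1), by positivity, fun i a b ha hb => ?_⟩
    have hei : ‖e i‖ ≤ |D| + 1 := (he i).trans ((le_abs_self D).trans (by linarith))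
    rw [← sub_smul, norm_smul]
    calc ‖k a - k b‖ * ‖e i‖
        ≤ (ε / (|D| + 1) * (|a| ^ p + |b| ^ p) + C * |a - b| ^ p) * (|D| + 1) := by
          gcongr
          exact hC a b ha hb
      _ = ε * (‖a‖ ^ p + ‖b‖ ^ p) + C * (|D| + 1) * ‖a - b‖ ^ p := by
          simp only [Real.norm_eq_abs]
          field_simp

end IsSmallPow

/-! ### Integrability of the negative powers of the symbol -/

section Symbol

variable {N : ℕ}

theorem symbol_eq_sum (k : Fin N → ℝ) : symbol k = ∑ j, 4 * Real.sin (k j / 2) ^ 2 := by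
  have h : ∀ j, 4 * Real.sin (k j / 2) ^ 2 = 2 - 2 * Real.cos (k j) := fun j => by
    rw [Real.sin_sq_eq_half_sub, mul_div_cancel₀ _ two_ne_zero]
    ring
  simp only [h, symbol, Finset.sum_sub_distrib, ← Finset.mul_sum]
  simp [mul_comm]

theorem four_sin_sq_le_symbol (k : Fin N → ℝ) (j : Fin N) :
    4 * Real.sin (k j / 2) ^ 2 ≤ symbol k := by
  rw [symbol_eq_sum]
  exact Finset.single_le_sum (f := fun j => 4 * Real.sin (k j / 2) ^ 2)
    (fun i _ => by positivity) (Finset.mem_univ j)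

theorem symbol_nonneg (k : Fin N → ℝ) : 0 ≤ symbol k := by
  rw [symbol_eq_sum]
  positivity

theorem continuous_symbol : Continuous (symbol : (Fin N → ℝ) → ℝ) := by
  unfold symbol
  fun_prop

theorem torus_ae_eq : (Set.univ.pi fun _ : Fin N => Set.Ioo (0 : ℝ) (2 * Real.pi)) =ᵐ[volume]
    torus N :=
  Measure.univ_pi_Ioo_ae_eq_Icc (f := fun _ : Fin N => (0 : ℝ))

theorem restrict_torus : (volume : Measure (Fin N → ℝ)).restrict (torus N) =
    Measure.pi fun _ : Fin N => (volume : Measure ℝ).restrict (Set.Ioo 0 (2 * Real.pi)) := by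
  rw [← Measure.restrict_congr_set torus_ae_eq, volume_pi, Measure.restrict_pi_pi]

instance isFiniteMeasure_restrict_torus :
    IsFiniteMeasure ((volume : Measure (Fin N → ℝ)).restrict (torus N)) := by
  rw [restrict_torus]
  infer_instance

theorem integrableOn_torus_of_continuous {g : (Fin N → ℝ) → ℝ} (hg : Continuous g) :
    IntegrableOn g (torus N) :=
  hg.continuousOn.integrableOn_compact isCompact_Icc

theorem ae_torus_sin_half_pos : ∀ᵐ k ∂(volume : Measure (Fin N → ℝ)).restrict (torus N),
    ∀ j, 0 < Real.sin (k j / 2) := by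
  rw [← Measure.restrict_congr_set torus_ae_eq]
  filter_upwards [ae_restrict_mem (MeasurableSet.univ_pi fun _ => measurableSet_Ioo)] with k hk j
  obtain ⟨h₁, h₂⟩ := hk j (Set.mem_univ j)
  exact Real.sin_pos_of_pos_of_lt_pi (by linarith) (by linarith)

theorem ae_symbol_pos (hN : 0 < N) : ∀ᵐ k ∂(volume : Measure (Fin N → ℝ)).restrict (torus N),
    0 < symbol k := by
  filter_upwards [ae_torus_sin_half_pos] with k hk
  have := hk ⟨0, hN⟩
  exact lt_of_lt_of_le (by positivity) (four_sin_sq_le_symbol k ⟨0, hN⟩)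

theorem four_sin_sq_rpow_neg_le {β t r : ℝ} (hβ : 0 ≤ β) (hr : 0 < r)
    (h : r / Real.pi ≤ Real.sin (t / 2)) :
    (4 * Real.sin (t / 2) ^ 2) ^ (-β) ≤ (4 / Real.pi ^ 2) ^ (-β) * r ^ (-(2 * β)) := by
  calc (4 * Real.sin (t / 2) ^ 2) ^ (-β) ≤ (4 * (r / Real.pi) ^ 2) ^ (-β) :=
        Real.rpow_le_rpow_of_nonpos (by positivity) (by gcongr) (neg_nonpos.2 hβ)
    _ = (4 / Real.pi ^ 2 * r ^ 2) ^ (-β) := by congr 1; ring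
    _ = (4 / Real.pi ^ 2) ^ (-β) * r ^ (-(2 * β)) := by
        rw [Real.mul_rpow (by positivity) (by positivity), ← mul_neg, Real.rpow_mul hr.le,
          Real.rpow_two]

theorem integrableOn_four_sin_sq_rpow_neg {β : ℝ} (hβ : 0 ≤ β) (hβ' : β < 1 / 2) :
    IntegrableOn (fun t : ℝ => (4 * Real.sin (t / 2) ^ 2) ^ (-β)) (Set.Ioo 0 (2 * Real.pi)) := by
  have hleft : IntervalIntegrable (fun t : ℝ => t ^ (-(2 * β))) volume 0 (2 * Real.pi) :=
    intervalIntegral.intervalIntegrable_rpow' (by linarith)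
  have hright : IntervalIntegrable (fun t : ℝ => (2 * Real.pi - t) ^ (-(2 * β))) volume 0
      (2 * Real.pi) := by
    simpa using (hleft.comp_sub_left (2 * Real.pi)).symm
  have hbound : IntegrableOn (fun t : ℝ => (4 / Real.pi ^ 2) ^ (-β) *
      (t ^ (-(2 * β)) + (2 * Real.pi - t) ^ (-(2 * β)))) (Set.Ioo 0 (2 * Real.pi)) :=
    (intervalIntegrable_iff_integrableOn_Ioo_of_le (by positivity)).1
      ((hleft.add hright).const_mul _)
  refine hbound.mono' (Measurable.aestronglyMeasurable (by fun_prop)) ?_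
  refine ae_restrict_of_forall_mem measurableSet_Ioo fun t ht => ?_
  have ht₁ : 0 < t := ht.1
  have ht₂ : 0 < 2 * Real.pi - t := by linarith [ht.2]
  rw [Real.norm_of_nonneg (by positivity), mul_add]
  rcases le_total t Real.pi with h | h
  · have hsin := Real.mul_le_sin (x := t / 2) (by linarith) (by linarith)
    rw [show 2 / Real.pi * (t / 2) = t / Real.pi by ring] at hsin
    exact (four_sin_sq_rpow_neg_le hβ ht₁ hsin).trans (le_add_of_nonneg_right (by positivity))
  · have hsin := Real.mul_le_sin (x := Real.pi - t / 2) (by linarith) (by linarith)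
    rw [Real.sin_pi_sub, show 2 / Real.pi * (Real.pi - t / 2) = (2 * Real.pi - t) / Real.pi by
      ring] at hsin
    exact (four_sin_sq_rpow_neg_le hβ ht₂ hsin).trans (le_add_of_nonneg_left (by positivity))

theorem integrableOn_symbol_rpow_neg {s : ℝ} (hs : 0 ≤ s) (hsN : 2 * s < N) :
    IntegrableOn (fun k : Fin N → ℝ => symbol k ^ (-s)) (torus N) := by
  have hN : (0 : ℝ) < N := by linarith
  -- Each factor `4 sin² (k_j / 2)` of the bound is at most the symbol and carries `1 / N`-th of
  -- the exponent, which makes it integrable in one variable.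
  have hprod : IntegrableOn (fun k : Fin N → ℝ =>
      ∏ j, (4 * Real.sin (k j / 2) ^ 2) ^ (-(s / N))) (torus N) := by
    rw [IntegrableOn, restrict_torus]
    refine Integrable.fintype_prod (f := fun _ t => (4 * Real.sin (t / 2) ^ 2) ^ (-(s / N)))
      fun _ => integrableOn_four_sin_sq_rpow_neg (by positivity) ?_
    rw [div_lt_div_iff₀ hN two_pos]
    linarith
  refine hprod.mono' (continuous_symbol.measurable.pow_const _).aestronglyMeasurable ?_
  filter_upwards [ae_torus_sin_half_pos] with k hk
  have hsymbol := symbol_nonneg k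
  rw [Real.norm_of_nonneg (by positivity)]
  calc symbol k ^ (-s) = ∏ _j : Fin N, symbol k ^ (-(s / N)) := by
        rw [Finset.prod_const, Finset.card_univ, Fintype.card_fin, ← Real.rpow_natCast,
          ← Real.rpow_mul hsymbol, neg_mul, div_mul_cancel₀ _ hN.ne']
    _ ≤ ∏ j, (4 * Real.sin (k j / 2) ^ 2) ^ (-(s / N)) := by
        refine Finset.prod_le_prod (fun j _ => by positivity) fun j _ => ?_
        have := hk j
        exact Real.rpow_le_rpow_of_nonpos (by positivity) (four_sin_sq_le_symbol k j)
          (neg_nonpos.2 (by positivity))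

end Symbol

/-! ### Cosine coefficients -/

section CosCoeff

variable {N : ℕ} {g : (Fin N → ℝ) → ℝ}

/-- The pairing `x · k` of a lattice point with a frequency. -/
def pairing (x : Fin N → ℤ) (k : Fin N → ℝ) : ℝ := ∑ j, (x j : ℝ) * k j

/-- The unnormalized Fourier cosine coefficients of a function on the torus. -/
def cosCoeff (g : (Fin N → ℝ) → ℝ) (z : Fin N → ℤ) : ℝ :=
  ∫ k in torus N, Real.cos (pairing z k) * g k

@[fun_prop]
theorem continuous_pairing (x : Fin N → ℤ) : Continuous (pairing x) := by
  unfold pairing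
  fun_prop

theorem pairing_add (x y : Fin N → ℤ) (k : Fin N → ℝ) :
    pairing (x + y) k = pairing x k + pairing y k := by
  simp [pairing, add_mul, Finset.sum_add_distrib]

theorem pairing_sub (x y : Fin N → ℤ) (k : Fin N → ℝ) :
    pairing (x - y) k = pairing x k - pairing y k := by
  simp [pairing, sub_mul, Finset.sum_sub_distrib]

theorem pairing_single_one (j : Fin N) (k : Fin N → ℝ) : pairing (Pi.single j 1) k = k j := by
  simp [pairing, Pi.single_apply]

theorem cosCoeff_eq_re_integral_exp (hg : IntegrableOn g (torus N)) (z : Fin N → ℤ) :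
    cosCoeff g z = (∫ k in torus N, Complex.exp (pairing z k * Complex.I) * g k).re := by
  have hint : IntegrableOn (fun k => Complex.exp (pairing z k * Complex.I) * (g k : ℂ))
      (torus N) :=
    hg.ofReal.bdd_mul (c := 1) (Continuous.aestronglyMeasurable (by fun_prop))
      (.of_forall fun k => (Complex.norm_exp_ofReal_mul_I _).le)
  rw [← RCLike.re_eq_complex_re, ← integral_re hint]
  simp only [RCLike.re_eq_complex_re, Complex.re_mul_ofReal, Complex.exp_ofReal_mul_I_re, cosCoeff]

/-- The linear form `k ↦ w · k`, as a homeomorphism onto the dual of the frequency space. -/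
def dotDual (N : ℕ) : (Fin N → ℝ) ≃L[ℝ] StrongDual ℝ (Fin N → ℝ) :=
  ((dotProductEquiv ℝ (Fin N)).trans LinearMap.toContinuousLinearMap).toContinuousLinearEquiv

theorem tendsto_cosCoeff_cofinite (hg : IntegrableOn g (torus N)) :
    Tendsto (cosCoeff g) cofinite (𝓝 0) := by
  have hcast : Tendsto (fun (z : Fin N → ℤ) j => (z j : ℝ)) cofinite (cocompact (Fin N → ℝ)) := by
    rw [← coprodᵢ_cofinite, ← coprodᵢ_cocompact]
    exact Tendsto.pi_map_coprodᵢ fun _ => Int.tendsto_coe_cofinite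
  have hπ : -(2 * Real.pi)⁻¹ ≠ 0 := neg_ne_zero.2 (inv_ne_zero (by positivity))
  have hdual := (dotDual N).toHomeomorph.isClosedEmbedding.tendsto_cocompact.comp
    ((Homeomorph.smulOfNeZero _ hπ).isClosedEmbedding.tendsto_cocompact.comp hcast)
  have hRL := (tendsto_integral_exp_smul_cocompact
    ((torus N).indicator fun k => (g k : ℂ)) volume).comp hdual
  refine ((Complex.continuous_re.tendsto' 0 0 rfl).comp hRL).congr fun z => ?_
  rw [cosCoeff_eq_re_integral_exp hg, ← integral_indicator (s := torus N) measurableSet_Icc]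
  simp only [Function.comp_apply]
  congr 2 with k
  have hw : dotDual N (-(2 * Real.pi)⁻¹ • fun j => (z j : ℝ)) k =
      -(2 * Real.pi)⁻¹ * pairing z k := by
    simp [dotDual, pairing, dotProduct, Finset.mul_sum, mul_assoc]
  have hphase : 2 * Real.pi * -(-(2 * Real.pi)⁻¹ * pairing z k) = pairing z k := by
    field_simp
  simp only [Homeomorph.smulOfNeZero_apply, ContinuousLinearEquiv.coe_toHomeomorph,
    Circle.smul_def, Real.fourierChar_apply, smul_eq_mul]
  by_cases hk : k ∈ torus N
  · rw [Set.indicator_of_mem hk, Set.indicator_of_mem hk, hw, hphase]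
  · rw [Set.indicator_of_notMem hk, Set.indicator_of_notMem hk, mul_zero]

/-- The plane wave of wave vector `x`, weighted by `√g`. -/
def planeWave (g : (Fin N → ℝ) → ℝ) (x : Fin N → ℤ) (k : Fin N → ℝ) : ℂ :=
  Complex.exp (pairing x k * Complex.I) * √(g k)

theorem memLp_planeWave (hg : IntegrableOn g (torus N)) (hg₀ : 0 ≤ g) (x : Fin N → ℤ) :
    MemLp (planeWave g x) 2 (volume.restrict (torus N)) := by
  have hm : AEStronglyMeasurable (planeWave g x) (volume.restrict (torus N)) := by
    have hsqrt := Real.continuous_sqrt.comp_aestronglyMeasurable hg.aestronglyMeasurable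
    exact (Continuous.aestronglyMeasurable (by fun_prop)).mul
      (Complex.continuous_ofReal.comp_aestronglyMeasurable hsqrt)
  refine (memLp_two_iff_integrable_sq_norm hm).2 (Integrable.congr hg (.of_forall fun k => ?_))
  simp only [planeWave, norm_mul, Complex.norm_exp_ofReal_mul_I, one_mul, Complex.norm_real,
    Real.norm_eq_abs, sq_abs, Real.sq_sqrt (hg₀ k)]

theorem inner_planeWave (hg₀ : 0 ≤ g) (x y : Fin N → ℤ) (k : Fin N → ℝ) :
    inner ℝ (planeWave g x k) (planeWave g y k) = Real.cos (pairing (x - y) k) * g k := by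
  have hphase : planeWave g y k * (starRingEnd ℂ) (planeWave g x k) =
      Complex.exp ((-pairing (x - y) k : ℝ) * Complex.I) * ((√(g k) * √(g k) : ℝ) : ℂ) := by
    simp only [planeWave, map_mul, ← Complex.exp_conj, Complex.conj_ofReal, Complex.conj_I,
      pairing_sub]
    rw [mul_mul_mul_comm, ← Complex.exp_add]
    push_cast
    ring_nf
  rw [Complex.inner, hphase, Real.mul_self_sqrt (hg₀ k), Complex.re_mul_ofReal,
    Complex.exp_ofReal_mul_I_re, Real.cos_neg]

theorem exists_inner_eq_cosCoeff_sub (hg : IntegrableOn g (torus N)) (hg₀ : 0 ≤ g) :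
    ∃ e : (Fin N → ℤ) → Lp ℂ 2 ((volume : Measure (Fin N → ℝ)).restrict (torus N)),
      ∀ x y, inner ℝ (e x) (e y) = cosCoeff g (x - y) := by
  refine ⟨fun x => (memLp_planeWave hg hg₀ x).toLp, fun x y => ?_⟩
  rw [L2.inner_def, cosCoeff]
  refine integral_congr_ae ?_
  filter_upwards [(memLp_planeWave hg hg₀ x).coeFn_toLp, (memLp_planeWave hg hg₀ y).coeFn_toLp]
    with k hx hy
  rw [hx, hy, inner_planeWave hg₀]

end CosCoeff

/-! ### Positivity of the cosine coefficients of the negative powers of the symbol -/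

section Positivity

variable {N : ℕ}

theorem integral_exp_int_mul_I (m : ℤ) :
    ∫ t in Set.Ioo 0 (2 * Real.pi), Complex.exp (((m : ℝ) * t : ℝ) * Complex.I) =
      ((if m = 0 then 2 * Real.pi else 0 : ℝ) : ℂ) := by
  rw [← integral_Ioc_eq_integral_Ioo, ← intervalIntegral.integral_of_le (by positivity)]
  rcases eq_or_ne m 0 with rfl | hm
  · simp
  have hm' : (m : ℂ) * Complex.I ≠ 0 := mul_ne_zero (by exact_mod_cast hm) Complex.I_ne_zero
  have hcomm : ∀ t : ℝ, (((m : ℝ) * t : ℝ) : ℂ) * Complex.I = (m : ℂ) * Complex.I * t := fun t => by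
    push_cast
    ring
  have hperiod : (m : ℂ) * Complex.I * ((2 * Real.pi : ℝ) : ℂ) = m * (2 * Real.pi * Complex.I) := by
    push_cast
    ring
  simp only [hcomm]
  rw [integral_exp_mul_complex hm', hperiod, Complex.exp_int_mul_two_pi_mul_I, if_neg hm]
  simp

theorem cosCoeff_one_nonneg (z : Fin N → ℤ) : 0 ≤ cosCoeff (fun _ => 1) z := by
  have hprod : ∀ k : Fin N → ℝ, Complex.exp (pairing z k * Complex.I) * ((1 : ℝ) : ℂ) =
      ∏ j, Complex.exp (((z j : ℝ) * k j : ℝ) * Complex.I) := fun k => by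
    rw [← Complex.exp_sum, pairing, Complex.ofReal_sum, Finset.sum_mul, Complex.ofReal_one, mul_one]
  rw [cosCoeff_eq_re_integral_exp (integrable_const 1)]
  simp only [hprod]
  rw [restrict_torus, integral_fintype_prod_eq_prod (𝕜 := ℂ)
    fun j (t : ℝ) => Complex.exp (((z j : ℝ) * t : ℝ) * Complex.I)]
  simp only [integral_exp_int_mul_I, ← Complex.ofReal_prod, Complex.ofReal_re]
  exact Finset.prod_nonneg fun j _ => by positivity

theorem cosCoeff_const_mul (c : ℝ) (g : (Fin N → ℝ) → ℝ) (z : Fin N → ℤ) :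
    cosCoeff (fun k => c * g k) z = c * cosCoeff g z := by
  simp only [cosCoeff, mul_left_comm _ c, integral_const_mul]

theorem cosCoeff_mul_sum_cos {g : (Fin N → ℝ) → ℝ} (hg : Continuous g) (z : Fin N → ℤ) :
    cosCoeff (fun k => g k * ∑ j, Real.cos (k j)) z =
      ∑ j, (cosCoeff g (z + Pi.single j 1) + cosCoeff g (z - Pi.single j 1)) / 2 := by
  have hcos : ∀ k : Fin N → ℝ, Real.cos (pairing z k) * (g k * ∑ j, Real.cos (k j)) =
      ∑ j, (Real.cos (pairing (z + Pi.single j 1) k) * g k +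
        Real.cos (pairing (z - Pi.single j 1) k) * g k) / 2 := fun k => by
    rw [← mul_assoc, Finset.mul_sum]
    refine Finset.sum_congr rfl fun j _ => ?_
    rw [pairing_add, pairing_sub, pairing_single_one, Real.cos_add, Real.cos_sub]
    ring
  have hint : ∀ w, IntegrableOn (fun k => Real.cos (pairing w k) * g k) (torus N) := fun w =>
    integrableOn_torus_of_continuous (by fun_prop)
  simp only [cosCoeff, hcos]
  rw [integral_finsetSum _ fun j _ => by exact ((hint _).add (hint _)).div_const 2]
  refine Finset.sum_congr rfl fun j _ => ?_
  rw [integral_div, integral_add (hint _) (hint _)]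

theorem cosCoeff_sum_cos_pow_nonneg (n : ℕ) (z : Fin N → ℤ) :
    0 ≤ cosCoeff (fun k => (∑ j, Real.cos (k j)) ^ n) z := by
  induction n generalizing z with
  | zero => simpa using cosCoeff_one_nonneg z
  | succ n ih =>
    simp only [pow_succ]
    rw [cosCoeff_mul_sum_cos (by fun_prop)]
    exact Finset.sum_nonneg fun j _ => div_nonneg (add_nonneg (ih _) (ih _)) two_pos.le

theorem multichoose_nonneg {s : ℝ} (hs : 0 < s) (n : ℕ) : 0 ≤ Ring.multichoose s n := by
  have h := ascPochhammer_pos n s hs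
  rw [← Polynomial.ascPochhammer_smeval_eq_eval,
    ← Ring.factorial_nsmul_multichoose_eq_ascPochhammer s n, nsmul_eq_mul] at h
  exact (pos_of_mul_pos_right h (by positivity)).le

theorem hasSum_one_sub_rpow_neg {s q : ℝ} (hq : |q| < 1) :
    HasSum (fun n : ℕ => Ring.multichoose s n * q ^ n) ((1 - q) ^ (-s)) := by
  have h := (Real.one_div_one_sub_rpow_hasFPowerSeriesOnBall_zero s).hasSum (y := q)
    (by simpa [enorm_eq_nnnorm] using! hq)
  simp only [FormalMultilinearSeries.ofScalars_apply_eq, smul_eq_mul, zero_add,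
    ← Ring.multichoose_eq] at h
  rw [Real.rpow_neg (by linarith [le_abs_self q])]
  simpa using h

theorem abs_mul_sum_cos_le {c : ℝ} (hc : 0 ≤ c) (k : Fin N → ℝ) :
    |c * ∑ j, Real.cos (k j)| ≤ c * N := by
  rw [abs_mul, abs_of_nonneg hc]
  refine mul_le_mul_of_nonneg_left ((Finset.abs_sum_le_sum_abs _ _).trans ?_) hc
  simpa using Finset.sum_le_card_nsmul Finset.univ _ 1 fun j _ => Real.abs_cos_le_one (k j)

theorem cosCoeff_one_sub_mul_sum_cos_rpow_neg_nonneg {s c : ℝ} (hs : 0 < s) (hc : 0 ≤ c)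
    (hcN : c * N < 1) (z : Fin N → ℤ) :
    0 ≤ cosCoeff (fun k => (1 - c * ∑ j, Real.cos (k j)) ^ (-s)) z := by
  have hbinom := (hasSum_one_sub_rpow_neg (s := s) (q := c * N)
    (by rwa [abs_of_nonneg (by positivity)])).summable
  have hsum : HasSum (fun n : ℕ =>
        cosCoeff (fun k => Ring.multichoose s n * (c * ∑ j, Real.cos (k j)) ^ n) z)
      (cosCoeff (fun k => (1 - c * ∑ j, Real.cos (k j)) ^ (-s)) z) := by
    refine hasSum_integral_of_dominated_convergence
      (fun n _ => Ring.multichoose s n * (c * N) ^ n)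
      (fun n => Continuous.aestronglyMeasurable (by fun_prop))
      (fun n => .of_forall fun k => ?_) (.of_forall fun _ => hbinom) (integrable_const _)
      (.of_forall fun k =>
        (hasSum_one_sub_rpow_neg ((abs_mul_sum_cos_le hc k).trans_lt hcN)).mul_left _)
    have hn := multichoose_nonneg hs n
    rw [norm_mul, norm_mul, norm_pow, Real.norm_of_nonneg hn, Real.norm_eq_abs (c * _)]
    refine (mul_le_of_le_one_left (by positivity) (Real.abs_cos_le_one _)).trans ?_
    gcongr
    exact abs_mul_sum_cos_le hc k
  refine hsum.nonneg fun n => ?_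
  simp only [mul_pow, cosCoeff_const_mul]
  exact mul_nonneg (multichoose_nonneg hs n)
    (mul_nonneg (by positivity) (cosCoeff_sum_cos_pow_nonneg n z))

theorem cosCoeff_symbol_add_rpow_neg_nonneg {s ε : ℝ} (hs : 0 < s) (hε : 0 < ε)
    (z : Fin N → ℤ) : 0 ≤ cosCoeff (fun k => (symbol k + ε) ^ (-s)) z := by
  have hd : (0 : ℝ) < 2 * N + ε := by positivity
  have hc : 0 ≤ 2 / (2 * N + ε) := by positivity
  have hcN : 2 / (2 * N + ε) * N < 1 := by
    rw [div_mul_eq_mul_div, div_lt_one hd]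
    linarith
  have hsymbol : ∀ k : Fin N → ℝ, (symbol k + ε) ^ (-s) =
      (2 * N + ε) ^ (-s) * (1 - 2 / (2 * N + ε) * ∑ j, Real.cos (k j)) ^ (-s) := fun k => by
    have := (abs_le.1 (abs_mul_sum_cos_le hc k)).2
    rw [← Real.mul_rpow hd.le (by linarith), symbol]
    congr 1
    field_simp
    ring
  simp only [hsymbol, cosCoeff_const_mul]
  exact mul_nonneg (by positivity) (cosCoeff_one_sub_mul_sum_cos_rpow_neg_nonneg hs hc hcN z)

theorem cosCoeff_symbol_rpow_neg_nonneg {s : ℝ} (hs : 0 < s) (hsN : 2 * s < N)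
    (z : Fin N → ℤ) : 0 ≤ cosCoeff (fun k => symbol k ^ (-s)) z := by
  have hpos := ae_symbol_pos (N := N) (by exact_mod_cast (by linarith : (0 : ℝ) < N))
  have hlim : Tendsto (fun ε : ℝ => cosCoeff (fun k => (symbol k + ε) ^ (-s)) z) (𝓝[>] 0)
      (𝓝 (cosCoeff (fun k => symbol k ^ (-s)) z)) := by
    refine tendsto_integral_filter_of_dominated_convergence (fun k => symbol k ^ (-s))
      (.of_forall fun ε => ?_) ?_ (integrableOn_symbol_rpow_neg hs.le hsN) ?_
    · exact (Continuous.aestronglyMeasurable (by fun_prop)).mul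
        ((continuous_symbol.measurable.add_const _).pow_const _).aestronglyMeasurable
    · filter_upwards [self_mem_nhdsWithin] with ε (hε : 0 < ε)
      filter_upwards [hpos] with k hk
      rw [norm_mul, Real.norm_of_nonneg (by positivity : 0 ≤ (symbol k + ε) ^ (-s))]
      refine (mul_le_of_le_one_left (by positivity) (Real.abs_cos_le_one _)).trans ?_
      exact Real.rpow_le_rpow_of_nonpos hk (by linarith) (by linarith)
    · filter_upwards [hpos] with k hk
      have hadd : Tendsto (fun ε : ℝ => symbol k + ε) (𝓝[>] 0) (𝓝 (symbol k)) := by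
        exact ((continuous_const.add continuous_id).tendsto' 0 _ (add_zero _)).mono_left
          nhdsWithin_le_nhds
      exact (hadd.rpow_const (Or.inl hk.ne')).const_mul _
  refine ge_of_tendsto hlim ?_
  filter_upwards [self_mem_nhdsWithin] with ε hε
  exact cosCoeff_symbol_add_rpow_neg_nonneg hs hε z

end Positivity

/-! ### The Green's function -/

section Green

variable {N : ℕ} {α : ℝ}

theorem green_add_right (α : ℝ) (x y z : Fin N → ℤ) :
    green α (x + z) (y + z) = green α x y := by
  simp [green]

theorem fracDegree_nonneg (α : ℝ) : 0 ≤ fracDegree N α :=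
  mul_nonneg (by positivity) (integral_nonneg fun k => Real.rpow_nonneg (symbol_nonneg k) _)

theorem green_eq_cosCoeff (hα : 0 ≤ α) (hαN : α < N) (x y : Fin N → ℤ) :
    green α x y =
      fracDegree N α / (2 * Real.pi) ^ N * cosCoeff (fun k => symbol k ^ (-(α / 2))) (x - y) := by
  rw [green, Complex.re_ofReal_mul, cosCoeff_eq_re_integral_exp
    (integrableOn_symbol_rpow_neg (by positivity) (by linarith))]
  simp only [pairing, Pi.sub_apply, mul_comm Complex.I]

theorem green_nonneg (hα : 0 < α) (hαN : α < N) (x y : Fin N → ℤ) : 0 ≤ green α x y := by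
  rw [green_eq_cosCoeff hα.le hαN]
  have := fracDegree_nonneg (N := N) α
  exact mul_nonneg (by positivity)
    (cosCoeff_symbol_rpow_neg_nonneg (by positivity) (by linarith) _)

theorem tendsto_green_cofinite (hα : 0 ≤ α) (hαN : α < N) (y : Fin N → ℤ) :
    Tendsto (fun x => green α x y) cofinite (𝓝 0) := by
  have h := (tendsto_cosCoeff_cofinite (integrableOn_symbol_rpow_neg (N := N) (s := α / 2)
    (by positivity) (by linarith))).comp (sub_left_injective (b := y)).tendsto_cofinite
  simpa only [green_eq_cosCoeff hα hαN, mul_zero, Function.comp_def] using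
    h.const_mul (fracDegree N α / (2 * Real.pi) ^ N)

theorem exists_inner_eq_green (hα : 0 ≤ α) (hαN : α < N) :
    ∃ e : (Fin N → ℤ) → Lp ℂ 2 ((volume : Measure (Fin N → ℝ)).restrict (torus N)),
      ∀ x y, inner ℝ (e x) (e y) = green α x y := by
  have hc : 0 ≤ fracDegree N α / (2 * Real.pi) ^ N :=
    div_nonneg (fracDegree_nonneg α) (by positivity)
  obtain ⟨e, he⟩ := exists_inner_eq_cosCoeff_sub (N := N)
    ((integrableOn_symbol_rpow_neg (s := α / 2) (by positivity) (by linarith)).const_mul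
      (fracDegree N α / (2 * Real.pi) ^ N))
    fun k => mul_nonneg hc (Real.rpow_nonneg (symbol_nonneg k) _)
  exact ⟨e, fun x y => by rw [he, cosCoeff_const_mul, green_eq_cosCoeff hα hαN]⟩

end Green

/-! ### Superposition operators -/

section Hilbert

variable {β V : Type*} [NormedAddCommGroup V] [InnerProductSpace ℝ V] {l : Filter β}

theorem tendsto_inner_sub_inner {q q' r r' : β → V} {a b : V} {C : ℝ}
    (hq : Tendsto (fun n => q n - q' n) l (𝓝 a)) (hr : Tendsto (fun n => r n - r' n) l (𝓝 b))
    (hqC : ∀ n, ‖q' n‖ ≤ C) (hrC : ∀ n, ‖r' n‖ ≤ C)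
    (hqb : Tendsto (fun n => inner ℝ (q' n) b) l (𝓝 0))
    (hra : Tendsto (fun n => inner ℝ (r' n) a) l (𝓝 0)) :
    Tendsto (fun n => inner ℝ (q n) (r n) - inner ℝ (q' n) (r' n)) l (𝓝 (inner ℝ a b)) := by
  have cross : ∀ {s t : β → V} {c : V}, Tendsto t l (𝓝 c) → (∀ n, ‖s n‖ ≤ C) →
      Tendsto (fun n => inner ℝ (s n) c) l (𝓝 0) →
      Tendsto (fun n => inner ℝ (s n) (t n)) l (𝓝 0) := by
    intro s t c ht hs hsc
    have hdiff : Tendsto (fun n => inner ℝ (s n) (t n - c)) l (𝓝 0) := by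
      refine squeeze_zero_norm (fun n => (norm_inner_le_norm _ _).trans
        (mul_le_mul_of_nonneg_right (hs n) (norm_nonneg _))) ?_
      simpa using (tendsto_iff_norm_sub_tendsto_zero.1 ht).const_mul C
    simpa [inner_sub_right] using hdiff.add hsc
  have h := ((hq.inner hr).add (cross hr hqC hqb)).add (cross hq hrC hra)
  rw [add_zero, add_zero] at h
  refine h.congr fun n => ?_
  simp only [inner_sub_left, inner_sub_right, real_inner_comm (r' n)]
  ring

end Hilbert

section Superposition

variable {β ι X V : Type*} [NormedAddCommGroup X] [NormedSpace ℝ X] [NormedAddCommGroup V]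
  [InnerProductSpace ℝ V] {p B D : ℝ} {L : ι → X →L[ℝ] ℝ} {e : ι → V} {j k f : ℝ → ℝ}

/-- The vector `∑ k(u(x)) e(x)`. If `e` has Gram matrix `R`, the inner product of two such vectors
is a double sum against the kernel `R`. -/
def superpos (e : ι → V) (k : ℝ → ℝ) (u : ι → ℝ) : V := ∑' x, k (u x) • e x

theorem LpBounded.summable_abs_comp (hL : LpBounded p B L) (hk : IsSmallPow p k) (u : X) :
    Summable fun x => |k (L x u)| := by
  have hp := zero_lt_one.trans hL.one_lt
  have := (hk.brezisLieb (e := fun _ : ι => (1 : ℝ)) hp fun _ => norm_one.le).locallyGrowsLike hp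
  simpa using hL.summable_norm_comp_of_growth this u

theorem LpBounded.exists_tsum_abs_comp_le (hL : LpBounded p B L) (hk : IsSmallPow p k) (M : ℝ) :
    ∃ C, ∀ u, ‖u‖ ≤ M → ∑' x, |k (L x u)| ≤ C := by
  have hp := zero_lt_one.trans hL.one_lt
  have := (hk.brezisLieb (e := fun _ : ι => (1 : ℝ)) hp fun _ => norm_one.le).locallyGrowsLike hp
  simpa using hL.exists_tsum_norm_comp_le this M

theorem LpBounded.exists_norm_superpos_le (hL : LpBounded p B L) (hk : IsSmallPow p k)
    (he : ∀ x, ‖e x‖ ≤ D) (M : ℝ) :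
    ∃ C, ∀ u, ‖u‖ ≤ M → ‖superpos e k fun x => L x u‖ ≤ C := by
  have hp := zero_lt_one.trans hL.one_lt
  have hgrow := (hk.brezisLieb hp he).locallyGrowsLike hp
  obtain ⟨C, hC⟩ := hL.exists_tsum_norm_comp_le hgrow M
  exact ⟨C, fun u hu => (norm_tsum_le_tsum_norm (f := fun x => k (L x u) • e x)
    (hL.summable_norm_comp_of_growth hgrow u)).trans (hC u hu)⟩

theorem LpBounded.norm_superpos_le (hL : LpBounded p B L) (hD : 0 ≤ D) (he : ∀ x, ‖e x‖ ≤ D)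
    {ε : ℝ} (hε : 0 ≤ ε) {u : X} (hk : ∀ x, |k (L x u)| ≤ ε * |L x u| ^ p) :
    ‖superpos e k fun x => L x u‖ ≤ ε * (D * (B * ‖u‖) ^ p) := by
  have hsum : HasSum (fun x => ε * (D * |L x u| ^ p)) (ε * (D * ∑' x, |L x u| ^ p)) :=
    ((hL.summable_rpow u).hasSum.mul_left D).mul_left ε
  refine (tsum_of_norm_bounded hsum fun x => ?_).trans ?_
  · calc ‖k (L x u) • e x‖ = |k (L x u)| * ‖e x‖ := norm_smul _ _
      _ ≤ ε * |L x u| ^ p * D := by gcongr; exacts [hk x, he x]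
      _ = ε * (D * |L x u| ^ p) := by ring
  · gcongr
    exact hL.tsum_rpow_le u

/-- Two superpositions of functions that are `o(|t| ^ p)` can only have an inner product of the
size of `‖u‖ ^ p` if `u` is not uniformly small. -/
theorem LpBounded.exists_lt_abs_apply (hL : LpBounded p B L) (hD : 0 ≤ D) (he : ∀ x, ‖e x‖ ≤ D)
    (hj : IsSmallPow p j) (hk : IsSmallPow p k) (M : ℝ) :
    ∃ δ > 0, ∀ u, u ≠ 0 → ‖u‖ ≤ M →
      ‖u‖ ^ p ≤ inner ℝ (superpos e j fun x => L x u) (superpos e k fun x => L x u) →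
        ∃ x, δ < |L x u| := by
  have hp := zero_lt_one.trans hL.one_lt
  have hB := hL.nonneg
  set Q := (D * B ^ p) ^ 2 * |M| ^ p
  have hQ : 0 ≤ Q := by positivity
  set ε := (Q + 1)⁻¹
  have hε : 0 < ε := by positivity
  have hεQ : ε ^ 2 * Q < 1 := by
    rw [inv_pow, inv_mul_lt_iff₀ (by positivity)]
    nlinarith
  obtain ⟨δ₁, hδ₁, hjδ⟩ := hj.exists_abs_le hε
  obtain ⟨δ₂, hδ₂, hkδ⟩ := hk.exists_abs_le hε
  refine ⟨min δ₁ δ₂, by positivity, fun u hu huM hle => ?_⟩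
  by_contra! hsmall
  have hju := hL.norm_superpos_le hD he hε.le fun x => hjδ _ ((hsmall x).trans (min_le_left _ _))
  have hku := hL.norm_superpos_le hD he hε.le fun x => hkδ _ ((hsmall x).trans (min_le_right _ _))
  rw [Real.mul_rpow hB (norm_nonneg u)] at hju hku
  have hu0 : 0 < ‖u‖ ^ p := Real.rpow_pos_of_pos (norm_pos_iff.2 hu) p
  have huM' : ‖u‖ ^ p ≤ |M| ^ p := by
    gcongr
    exact huM.trans (le_abs_self M)
  have hlt : ‖u‖ ^ p < ‖u‖ ^ p :=
    calc ‖u‖ ^ p ≤ ε * (D * (B ^ p * ‖u‖ ^ p)) * (ε * (D * (B ^ p * ‖u‖ ^ p))) :=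
          hle.trans ((real_inner_le_norm _ _).trans (mul_le_mul hju hku (by positivity)
            (by positivity)))
      _ = ε ^ 2 * ((D * B ^ p) ^ 2 * ‖u‖ ^ p) * ‖u‖ ^ p := by ring
      _ ≤ ε ^ 2 * ((D * B ^ p) ^ 2 * |M| ^ p) * ‖u‖ ^ p := by gcongr
      _ < ‖u‖ ^ p := mul_lt_of_lt_one_left hu0 hεQ
  exact lt_irrefl _ hlt

/-- The derivative `v ↦ ∑ f(u(x)) v(x) e(x)` at `u` of the superposition operator of the primitive
of `f`. -/
def superposDeriv (L : ι → X →L[ℝ] ℝ) (e : ι → V) (f : ℝ → ℝ) (u : X) : X →L[ℝ] V :=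
  tsumComp L (fun x t => f t • ContinuousLinearMap.toSpanSingleton ℝ (e x)) u

theorem locallyGrowsLike_smul_toSpanSingleton (hp : 1 < p) (hf : IsSmallPow (p - 1) f)
    (he : ∀ x, ‖e x‖ ≤ D) : LocallyGrowsLike (p - 1) fun x (t : ℝ) =>
      f t • ContinuousLinearMap.toSpanSingleton ℝ (e x) :=
  (hf.brezisLieb (sub_pos.2 hp) (e := fun x => ContinuousLinearMap.toSpanSingleton ℝ (e x))
    fun x => (ContinuousLinearMap.norm_toSpanSingleton (e x)).trans_le (he x)).locallyGrowsLike
    (sub_pos.2 hp)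

variable [CompleteSpace V]

theorem hasSum_inner_superpos {u : ι → ℝ} (hu : Summable fun x => |k (u x)|)
    (he : ∀ x, ‖e x‖ ≤ D) (w : V) :
    HasSum (fun x => k (u x) * inner ℝ (e x) w) (inner ℝ (superpos e k u) w) := by
  have hsum : Summable fun x => k (u x) • e x := .of_norm_bounded (hu.mul_right D) fun x => by
    rw [norm_smul, Real.norm_eq_abs]
    exact mul_le_mul_of_nonneg_left (he x) (abs_nonneg _)
  simpa only [innerSL_apply_apply, inner_smul_right, real_inner_comm, superpos] using
    (innerSL ℝ w).hasSum hsum.hasSum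

theorem tendsto_inner_superpos_zero {l : Filter β} {w : β → V} {C : ℝ} (hw : ∀ n, ‖w n‖ ≤ C)
    (hlim : ∀ x, Tendsto (fun n => inner ℝ (e x) (w n)) l (𝓝 0)) (he : ∀ x, ‖e x‖ ≤ D)
    {u : ι → ℝ} (hu : Summable fun x => |k (u x)|) :
    Tendsto (fun n => inner ℝ (superpos e k u) (w n)) l (𝓝 0) := by
  have h := tendsto_tsum_of_dominated_convergence (f := fun n x => k (u x) * inner ℝ (e x) (w n))
    (hu.mul_right (D * C)) (fun x => (hlim x).const_mul _) <| .of_forall fun n x => by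
      rw [norm_mul, Real.norm_eq_abs]
      gcongr
      exact (norm_inner_le_norm _ _).trans (mul_le_mul (he x) (hw n) (norm_nonneg _)
        ((norm_nonneg _).trans (he x)))
  simp only [mul_zero, tsum_zero] at h
  exact h.congr fun n => (hasSum_inner_superpos hu he _).tsum_eq

namespace LpBounded

variable {u : β → X} {v : X} {M : ℝ} {l : Filter β}

/-- The decay of the Gram matrix away from the diagonal enters here. -/
theorem tendsto_inner_superpos_zero (hL : LpBounded p B L) (hj : IsSmallPow p j)
    (hk : IsSmallPow p k) (he : ∀ x, ‖e x‖ ≤ D)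
    (hgram : ∀ y, Tendsto (fun x => inner ℝ (e x) (e y)) cofinite (𝓝 0)) (hM : ∀ n, ‖u n‖ ≤ M)
    (hlim : ∀ x, Tendsto (fun n => L x (u n)) l (𝓝 0)) :
    Tendsto (fun n => inner ℝ (superpos e j fun x => L x (u n)) (superpos e k fun x => L x v)) l
      (𝓝 0) := by
  obtain ⟨C, hC⟩ := hL.exists_tsum_abs_comp_le hj M
  obtain ⟨C', hC'⟩ := hL.exists_norm_superpos_le hj he M
  have hgram_lim : ∀ y, Tendsto (fun n => inner ℝ (e y) (superpos e j fun x => L x (u n))) l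
      (𝓝 0) := fun y => by
    have hj₀ : ∀ x, Tendsto (fun n => j (L x (u n))) l (𝓝 0) := fun x => by
      simpa only [hj.apply_zero (zero_lt_one.trans hL.one_lt), Function.comp_def] using
        (hj.continuous.tendsto 0).comp (hlim x)
    refine (tendsto_tsum_mul_zero (fun n => hL.summable_abs_comp hj (u n))
      (fun n => hC _ (hM n)) hj₀ (hgram y)).congr fun n => ?_
    rw [(hasSum_inner_superpos (hL.summable_abs_comp hj (u n)) he (e y)).tsum_eq, real_inner_comm]
  simpa only [real_inner_comm] using Choquard.tendsto_inner_superpos_zero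
    (fun n => hC' _ (hM n)) hgram_lim he (hL.summable_abs_comp hk v)

theorem tendsto_inner_superpos_sub (hL : LpBounded p B L) (hj : IsSmallPow p j)
    (hk : IsSmallPow p k) (he : ∀ x, ‖e x‖ ≤ D)
    (hgram : ∀ y, Tendsto (fun x => inner ℝ (e x) (e y)) cofinite (𝓝 0)) (hM : ∀ n, ‖u n‖ ≤ M)
    (hlim : ∀ x, Tendsto (fun n => L x (u n)) l (𝓝 (L x v))) :
    Tendsto (fun n => inner ℝ (superpos e j fun x => L x (u n)) (superpos e k fun x => L x (u n)) -
        inner ℝ (superpos e j fun x => L x (u n - v)) (superpos e k fun x => L x (u n - v))) l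
      (𝓝 (inner ℝ (superpos e j fun x => L x v) (superpos e k fun x => L x v))) := by
  have hp := zero_lt_one.trans hL.one_lt
  have hM' : ∀ n, ‖u n - v‖ ≤ M + ‖v‖ := fun n => (norm_sub_le _ _).trans (by gcongr; exact hM n)
  have hlim' : ∀ x, Tendsto (fun n => L x (u n - v)) l (𝓝 0) := fun x => by
    simpa using (hlim x).sub_const (L x v)
  obtain ⟨C₁, hC₁⟩ := hL.exists_norm_superpos_le hj he (M + ‖v‖)
  obtain ⟨C₂, hC₂⟩ := hL.exists_norm_superpos_le hk he (M + ‖v‖)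
  exact tendsto_inner_sub_inner
    (hL.tendsto_tsum_sub_tsum (hj.brezisLieb hp he) hM hlim)
    (hL.tendsto_tsum_sub_tsum (hk.brezisLieb hp he) hM hlim)
    (fun n => (hC₁ _ (hM' n)).trans (le_max_left C₁ C₂))
    (fun n => (hC₂ _ (hM' n)).trans (le_max_right C₁ C₂))
    (hL.tendsto_inner_superpos_zero hj hk he hgram hM' hlim')
    (hL.tendsto_inner_superpos_zero hk hj he hgram hM' hlim')

theorem continuous_superposDeriv (hL : LpBounded p B L) (hf : IsSmallPow (p - 1) f)
    (he : ∀ x, ‖e x‖ ≤ D) : Continuous (superposDeriv L e f) :=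
  hL.continuous_tsumComp (locallyGrowsLike_smul_toSpanSingleton hL.one_lt hf he) fun _ =>
    hf.continuous.smul continuous_const

theorem hasSum_superposDeriv_apply (hL : LpBounded p B L) (hf : IsSmallPow (p - 1) f)
    (he : ∀ x, ‖e x‖ ≤ D) (u v : X) :
    HasSum (fun x => (f (L x u) * L x v) • e x) (superposDeriv L e f u v) := by
  have h := hL.hasSum_tsumComp_apply (locallyGrowsLike_smul_toSpanSingleton hL.one_lt hf he) u v
  simpa only [superposDeriv, FunLike.coe_smul, Pi.smul_apply,
    ContinuousLinearMap.toSpanSingleton_apply, smul_smul] using h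

theorem hasFDerivAt_superpos (hL : LpBounded p B L) (hf : IsSmallPow (p - 1) f)
    (he : ∀ x, ‖e x‖ ≤ D) (u : X) :
    HasFDerivAt (fun u => superpos e (primitive f) fun x => L x u) (superposDeriv L e f u) u := by
  have hp := zero_lt_one.trans hL.one_lt
  refine hL.hasFDerivAt_tsum_comp (g := fun x t => primitive f t • e x)
    (((hf.primitive hL.one_lt).brezisLieb hp he).locallyGrowsLike hp)
    (locallyGrowsLike_smul_toSpanSingleton hL.one_lt hf he) (fun x t => ?_) u
  have h := ((hasDerivAt_primitive hf.continuous t).smul_const (e x)).hasFDerivAt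
  rwa [ContinuousLinearMap.toSpanSingleton_smul] at h

end LpBounded

end Superposition

/-! ### The space `H` -/

section Lattice

variable {N : ℕ} {p : ℝ}

theorem nbrs_eq_map (x : Fin N → ℤ) : nbrs x = (nbrs 0).map (addLeftEmbedding x) := by
  ext y
  simp only [mem_nbrs, Finset.mem_map, addLeftEmbedding_apply]
  constructor
  · intro hy
    refine ⟨y - x, ?_, by abel⟩
    rw [← hy]
    exact Finset.sum_congr rfl fun i _ => by simp
  · rintro ⟨z, hz, rfl⟩
    rw [← hz]
    exact Finset.sum_congr rfl fun i _ => by simp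

theorem sum_nbrs_eq (g : (Fin N → ℤ) → ℝ) (x : Fin N → ℤ) :
    ∑ y ∈ nbrs x, g y = ∑ z ∈ nbrs 0, g (x + z) := by
  rw [nbrs_eq_map, Finset.sum_map]
  rfl

theorem mem_nbrs_comm (x y : Fin N → ℤ) : y ∈ nbrs x ↔ x ∈ nbrs y := by
  simp only [mem_nbrs, abs_sub_comm]

theorem notMem_nbrs_self (x : Fin N → ℤ) : x ∉ nbrs x := by
  simp [mem_nbrs]

theorem ne_of_mem_nbrs {x y : Fin N → ℤ} (hy : y ∈ nbrs x) : y ≠ x :=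
  fun h => notMem_nbrs_self x (h ▸ hy)

theorem gradNorm_comp_add_right (u : (Fin N → ℤ) → ℝ) (x z : Fin N → ℤ) :
    gradNorm (fun x => u (x + z)) x = gradNorm u (x + z) := by
  rw [gradNorm, gradNorm, gradForm, gradForm, sum_nbrs_eq, sum_nbrs_eq _ (x + z)]
  simp only [add_right_comm x _ z]

theorem gradNorm_le_sum (u : (Fin N → ℤ) → ℝ) (x : Fin N → ℤ) :
    gradNorm u x ≤ ∑ z ∈ nbrs 0, (|u (x + z)| + |u x|) := by
  calc gradNorm u x = √(1 / 2) * √(∑ y ∈ nbrs x, |u y - u x| ^ 2) := by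
        simp only [gradNorm_eq, sq_abs]
    _ ≤ 1 * √((∑ y ∈ nbrs x, |u y - u x|) ^ 2) := by
        gcongr
        · exact Real.sqrt_le_one.2 (by norm_num)
        · exact Finset.sum_sq_le_sq_sum_of_nonneg fun _ _ => abs_nonneg _
    _ = ∑ z ∈ nbrs 0, |u (x + z) - u x| := by
        rw [one_mul, Real.sqrt_sq (by positivity), sum_nbrs_eq fun y => |u y - u x|]
    _ ≤ _ := Finset.sum_le_sum fun _ _ => abs_sub _ _

theorem exists_gradNorm_rpow_le (N : ℕ) (hp : 1 ≤ p) :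
    ∃ C, ∀ (u : (Fin N → ℤ) → ℝ) x,
      gradNorm u x ^ p ≤ C * ∑ z ∈ nbrs 0, (|u (x + z)| ^ p + |u x| ^ p) := by
  have hpair : ∀ a b : ℝ, 0 ≤ a → 0 ≤ b → (a + b) ^ p ≤ 2 ^ (p - 1) * (a ^ p + b ^ p) :=
    fun a b ha hb => by
      lift a to NNReal using ha
      lift b to NNReal using hb
      exact_mod_cast NNReal.rpow_add_le_mul_rpow_add_rpow a b hp
  refine ⟨(nbrs (0 : Fin N → ℤ)).card ^ (p - 1) * 2 ^ (p - 1), fun u x => ?_⟩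
  calc gradNorm u x ^ p ≤ (∑ z ∈ nbrs 0, (|u (x + z)| + |u x|)) ^ p := by
        gcongr
        · exact gradNorm_nonneg u x
        · exact gradNorm_le_sum u x
    _ ≤ (nbrs (0 : Fin N → ℤ)).card ^ (p - 1) * ∑ z ∈ nbrs 0, (|u (x + z)| + |u x|) ^ p :=
        Real.rpow_sum_le_const_mul_sum_rpow_of_nonneg _ hp fun _ _ => by positivity
    _ ≤ (nbrs (0 : Fin N → ℤ)).card ^ (p - 1) *
          ∑ z ∈ nbrs 0, 2 ^ (p - 1) * (|u (x + z)| ^ p + |u x| ^ p) := by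
        gcongr with z
        exact hpair _ _ (abs_nonneg _) (abs_nonneg _)
    _ = _ := by rw [← Finset.mul_sum, mul_assoc]

theorem exists_tsum_density_le (N : ℕ) (hp : 1 ≤ p) :
    ∃ C, ∀ u : (Fin N → ℤ) → ℝ, (Summable fun x => |u x| ^ p) →
      Summable (density p 1 u) ∧ ∑' x, density p 1 u x ≤ C * ∑' x, |u x| ^ p := by
  obtain ⟨C, hgrad⟩ := exists_gradNorm_rpow_le N hp
  refine ⟨C * ((nbrs (0 : Fin N → ℤ)).card * 2) + 1, fun u hu => ?_⟩
  have hshift : ∀ z, HasSum (fun x => |u (x + z)| ^ p) (∑' x, |u x| ^ p) := fun z =>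
    (Equiv.addRight z).hasSum_iff.2 hu.hasSum
  have hmajor := ((hasSum_sum fun z (_ : z ∈ nbrs 0) =>
    (hshift z).add hu.hasSum).mul_left C).add hu.hasSum
  have hle : ∀ x, density p 1 u x ≤
      C * ∑ z ∈ nbrs 0, (|u (x + z)| ^ p + |u x| ^ p) + |u x| ^ p := fun x => by
    rw [density, Pi.one_apply, one_mul]
    exact add_le_add_left (hgrad u x) _
  have hs : Summable (density p 1 u) := hmajor.summable.of_nonneg_of_le
    (density_nonneg (fun _ => zero_le_one) u) hle
  refine ⟨hs, (hs.tsum_le_tsum hle hmajor.summable).trans_eq ?_⟩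
  rw [hmajor.tsum_eq, Finset.sum_const, nsmul_eq_mul]
  ring

theorem memW_of_summable (hp : 1 ≤ p) {u : (Fin N → ℤ) → ℝ} (hu : Summable fun x => |u x| ^ p) :
    MemW p u := by
  have hp₀ : 0 < p := by linarith
  obtain ⟨C, hdens⟩ := exists_tsum_density_le N hp
  have htrunc : ∀ s : Finset (Fin N → ℤ), (fun x => |(s : Set (Fin N → ℤ))ᶜ.indicator u x| ^ p) =
      (s : Set (Fin N → ℤ))ᶜ.indicator fun x => |u x| ^ p := fun s => by
    funext x
    by_cases hx : x ∈ s <;> simp [hx, hp₀.ne']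
  have htail : Tendsto (fun s : Finset (Fin N → ℤ) =>
      C * ∑' x, |(s : Set (Fin N → ℤ))ᶜ.indicator u x| ^ p) atTop (𝓝 0) := by
    simp only [htrunc, ← tsum_subtype]
    simpa using! (tendsto_tsum_compl_atTop_zero fun x => |u x| ^ p).const_mul C
  refine ⟨(hdens u hu).1, fun ε hε => ?_⟩
  obtain ⟨s, hs⟩ := (htail.eventually_lt_const (show 0 < ε ^ p by positivity)).exists
  refine ⟨(s : Set (Fin N → ℤ)).indicator u,
    s.finite_toSet.subset Set.support_indicator_subset, ?_⟩
  rw [← Set.indicator_compl]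
  have hdens := hdens ((s : Set (Fin N → ℤ))ᶜ.indicator u) (htrunc s ▸ hu.indicator _)
  refine ⟨hdens.1, ?_⟩
  rw [wnorm, one_div]
  exact (Real.rpow_inv_lt_iff_of_pos (tsum_nonneg (density_nonneg (fun _ => zero_le_one) _))
    hε.le hp₀).2 (hdens.2.trans_lt hs)

theorem summable_abs_rpow {h u : (Fin N → ℤ) → ℝ} (h₁ : ∃ h₀ > 0, ∀ x, h₀ ≤ h x)
    (hs : Summable fun x => h x * |u x| ^ p) : Summable fun x => |u x| ^ p := by
  obtain ⟨c, hc, hx⟩ := h₁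
  refine (hs.mul_left c⁻¹).of_nonneg_of_le (fun x => by positivity) fun x => ?_
  rw [inv_mul_eq_div, le_div_iff₀' hc]
  gcongr
  exact hx x

theorem gradForm_single_self (u : (Fin N → ℤ) → ℝ) (x : Fin N → ℤ) :
    gradForm u (Pi.single x 1) x = -(1 / 2) * ∑ y ∈ nbrs x, (u y - u x) := by
  rw [gradForm, neg_mul, ← mul_neg, ← Finset.sum_neg_distrib]
  congr 1
  refine Finset.sum_congr rfl fun y hy => ?_
  simp [ne_of_mem_nbrs hy]

theorem gradForm_single_of_ne (u : (Fin N → ℤ) → ℝ) {x y : Fin N → ℤ} (hyx : y ≠ x) :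
    gradForm u (Pi.single x 1) y = if y ∈ nbrs x then 1 / 2 * (u x - u y) else 0 := by
  have hsum : ∑ z ∈ nbrs y, (u z - u y) * ((Pi.single x 1 : (Fin N → ℤ) → ℝ) z -
      (Pi.single x 1 : (Fin N → ℤ) → ℝ) y) = if x ∈ nbrs y then u x - u y else 0 := by
    simp [Pi.single_apply, hyx]
  rw [gradForm, hsum]
  simp only [mem_nbrs_comm x y]
  split_ifs <;> simp

theorem hasSum_gradForm_single (p : ℝ) (u : (Fin N → ℤ) → ℝ) (x : Fin N → ℤ) :
    HasSum (fun y => gradNorm u y ^ (p - 2) * gradForm u (Pi.single x 1) y)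
      (-pLaplacian p u x) := by
  have hnbr : ∀ y ∈ nbrs x, gradForm u (Pi.single x 1) y = 1 / 2 * (u x - u y) := fun y hy => by
    rw [gradForm_single_of_ne u (ne_of_mem_nbrs hy), if_pos hy]
  have hs := hasSum_sum_of_ne_finset_zero (s := insert x (nbrs x))
    (L := SummationFilter.unconditional _)
    (f := fun y => gradNorm u y ^ (p - 2) * gradForm u (Pi.single x 1) y) fun y hy => by
      rw [Finset.mem_insert, not_or] at hy
      rw [gradForm_single_of_ne u hy.1, if_neg hy.2, mul_zero]
  convert hs using 1
  rw [Finset.sum_insert (notMem_nbrs_self x), gradForm_single_self, pLaplacian,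
    Finset.sum_congr rfl fun y hy => congrArg (gradNorm u y ^ (p - 2) * ·) (hnbr y hy),
    Finset.mul_sum, Finset.mul_sum, Finset.mul_sum, ← Finset.sum_add_distrib,
    ← Finset.sum_neg_distrib]
  exact Finset.sum_congr rfl fun y _ => by ring

end Lattice

section Space

variable {N : ℕ} {p : ℝ} {h : (Fin N → ℤ) → ℝ} {hp : 2 ≤ p} {h₁ : ∃ h₀ > 0, ∀ x, h₀ ≤ h x}

namespace HSpace

variable (hp h₁) in
/-- A function with `∑ h |u|^p < ∞`, as an element of `H`: on the lattice the gradient needs no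
summability assumption of its own. -/
def ofSummable (u : (Fin N → ℤ) → ℝ) (hs : Summable fun x => h x * |u x| ^ p) : HSpace p h hp h₁ :=
  ⟨u, memW_of_summable (by linarith) (summable_abs_rpow h₁ hs), hs⟩

@[simp] theorem smul_apply (c : ℝ) (u : HSpace p h hp h₁) (x) : (c • u) x = c * u x := rfl

@[simp] theorem zero_apply (x) : (0 : HSpace p h hp h₁) x = 0 := rfl

theorem norm_rpow (u : HSpace p h hp h₁) : ‖u‖ ^ p = ∑' x, density p h u x := by
  rw [norm_def, one_div, Real.rpow_inv_rpow _ (by linarith)]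
  · rfl
  · exact tsum_nonneg (density_nonneg (potential_nonneg h₁) u)

theorem sum_density_le (u : HSpace p h hp h₁) (s : Finset (Fin N → ℤ)) :
    ∑ x ∈ s, density p h u x ≤ ‖u‖ ^ p := by
  rw [norm_rpow]
  exact u.summable.sum_le_tsum s fun x _ => density_nonneg (potential_nonneg h₁) u x

variable (hp h₁) in
/-- Point evaluation on `H`. -/
def eval (x : Fin N → ℤ) : HSpace p h hp h₁ →L[ℝ] ℝ :=
  LinearMap.mkContinuous
    { toFun := fun u => u x, map_add' := fun _ _ => rfl, map_smul' := fun _ _ => rfl }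
    ((h x ^ (1 / p))⁻¹) fun u => by
      obtain ⟨c, hc, hch⟩ := id h₁
      have hp₀ : 0 < p := by linarith
      have hx : 0 < h x := hc.trans_le (hch x)
      have hle : h x * |u x| ^ p ≤ ‖u‖ ^ p := by
        refine le_trans ?_ (sum_density_le u {x})
        rw [Finset.sum_singleton, density]
        exact le_add_of_nonneg_left (Real.rpow_nonneg (gradNorm_nonneg _ _) _)
      refine (le_inv_mul_iff₀ (by positivity)).2 ?_
      refine (Real.rpow_le_rpow_iff (by positivity) (norm_nonneg u) hp₀).1 ?_
      rwa [Real.mul_rpow (by positivity) (norm_nonneg _), one_div,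
        Real.rpow_inv_rpow hx.le hp₀.ne']

@[simp] theorem eval_apply (x : Fin N → ℤ) (u : HSpace p h hp h₁) : eval hp h₁ x u = u x := rfl

variable (hp h₁) in
/-- The gradient at `x` as a vector indexed by the neighbours of `x`, scaled so that its Euclidean
norm is `gradNorm`. -/
def gradCLM (x : Fin N → ℤ) : HSpace p h hp h₁ →L[ℝ] EuclideanSpace ℝ (nbrs x) :=
  ((EuclideanSpace.equiv (nbrs x) ℝ).symm : (nbrs x → ℝ) →L[ℝ] EuclideanSpace ℝ (nbrs x)).comp
    (ContinuousLinearMap.pi fun y => √(1 / 2) • (eval hp h₁ (y : Fin N → ℤ) - eval hp h₁ x))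

theorem gradCLM_apply (x : Fin N → ℤ) (u : HSpace p h hp h₁) (y : nbrs x) :
    gradCLM hp h₁ x u y = √(1 / 2) * (u y - u x) := by
  simp [gradCLM]

theorem inner_gradCLM (x : Fin N → ℤ) (u v : HSpace p h hp h₁) :
    inner ℝ (gradCLM hp h₁ x u) (gradCLM hp h₁ x v) = gradForm u v x := by
  rw [PiLp.inner_apply, gradForm, ← Finset.sum_coe_sort (nbrs x), Finset.mul_sum]
  refine Finset.sum_congr rfl fun y _ => ?_
  have hsqrt : √(1 / 2 : ℝ) * √(1 / 2 : ℝ) = 1 / 2 := Real.mul_self_sqrt (by norm_num)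
  simp only [gradCLM_apply, RCLike.inner_apply, conj_trivial]
  linear_combination ((u y - u x) * (v y - v x)) * hsqrt

theorem norm_gradCLM (x : Fin N → ℤ) (u : HSpace p h hp h₁) :
    ‖gradCLM hp h₁ x u‖ = gradNorm u x := by
  rw [gradNorm, ← inner_gradCLM, norm_eq_sqrt_real_inner]

variable (hp h₁) in
/-- Point evaluation with the weight `h(x)^(1/p)`, the counterpart of `gradCLM` for the potential
term of the norm. -/
def potCLM (x : Fin N → ℤ) : HSpace p h hp h₁ →L[ℝ] ℝ := h x ^ (1 / p) • eval hp h₁ x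

theorem potCLM_apply (x : Fin N → ℤ) (u : HSpace p h hp h₁) :
    potCLM hp h₁ x u = h x ^ (1 / p) * u x := rfl

theorem norm_potCLM_rpow (x : Fin N → ℤ) (u : HSpace p h hp h₁) :
    ‖potCLM hp h₁ x u‖ ^ p = h x * |u x| ^ p := by
  have hx := potential_nonneg h₁ x
  rw [potCLM_apply, norm_mul, Real.norm_of_nonneg (by positivity), Real.norm_eq_abs,
    Real.mul_rpow (by positivity) (abs_nonneg _), one_div,
    Real.rpow_inv_rpow hx (by linarith)]

theorem lpBounded_gradCLM : LpBounded p 1 (gradCLM hp h₁) where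
  one_lt := by linarith
  nonneg := zero_le_one
  partialNorm_le s u := by
    refine (partialNorm_le_iff (by linarith) (by positivity)).2 ?_
    rw [one_mul]
    refine (Finset.sum_le_sum fun x _ => ?_).trans (sum_density_le u s)
    rw [norm_gradCLM, density]
    exact le_add_of_nonneg_right
      (mul_nonneg (potential_nonneg h₁ x) (Real.rpow_nonneg (abs_nonneg _) _))

theorem lpBounded_potCLM : LpBounded p 1 (potCLM hp h₁) where
  one_lt := by linarith
  nonneg := zero_le_one
  partialNorm_le s u := by
    refine (partialNorm_le_iff (by linarith) (by positivity)).2 ?_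
    rw [one_mul]
    refine (Finset.sum_le_sum fun x _ => ?_).trans (sum_density_le u s)
    rw [norm_potCLM_rpow, density]
    exact le_add_of_nonneg_left (Real.rpow_nonneg (gradNorm_nonneg _ _) _)

variable (hp h₁) in
theorem exists_lpBounded_eval : ∃ B, LpBounded p B (eval hp h₁) := by
  obtain ⟨c, hc, hch⟩ := id h₁
  have hp₀ : 0 < p := by linarith
  refine ⟨c⁻¹ ^ (1 / p), by linarith, by positivity, fun s u => ?_⟩
  refine (partialNorm_le_iff hp₀ (by positivity)).2 ?_
  rw [Real.mul_rpow (by positivity) (norm_nonneg _), one_div,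
    Real.rpow_inv_rpow (by positivity) hp₀.ne', inv_mul_eq_div, le_div_iff₀' hc, Finset.mul_sum]
  have hpot := lpBounded_potCLM.sum_rpow_le u s
  rw [one_mul] at hpot
  refine (Finset.sum_le_sum fun x _ => ?_).trans hpot
  rw [norm_potCLM_rpow, eval_apply, Real.norm_eq_abs]
  gcongr
  exact hch x

/-! ### The norm of `H` -/

theorem norm_rpow_eq_add (u : HSpace p h hp h₁) :
    ‖u‖ ^ p = ∑' x, ‖gradCLM hp h₁ x u‖ ^ p + ∑' x, ‖potCLM hp h₁ x u‖ ^ p := by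
  rw [norm_rpow, ← (lpBounded_gradCLM.summable_rpow u).tsum_add (lpBounded_potCLM.summable_rpow u)]
  simp only [norm_gradCLM, norm_potCLM_rpow, density]

/-- The derivative of `u ↦ ‖u‖ ^ p` on `H`. -/
def normRpowDeriv (u : HSpace p h hp h₁) : HSpace p h hp h₁ →L[ℝ] ℝ :=
  tsumRpowDeriv p (gradCLM hp h₁) u + tsumRpowDeriv p (potCLM hp h₁) u

theorem continuous_normRpowDeriv :
    Continuous (normRpowDeriv : HSpace p h hp h₁ → HSpace p h hp h₁ →L[ℝ] ℝ) :=
  lpBounded_gradCLM.continuous_tsumRpowDeriv.add lpBounded_potCLM.continuous_tsumRpowDeriv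

theorem hasFDerivAt_norm_rpow (u : HSpace p h hp h₁) :
    HasFDerivAt (fun u : HSpace p h hp h₁ => ‖u‖ ^ p) (normRpowDeriv u) u := by
  simp only [norm_rpow_eq_add]
  exact (lpBounded_gradCLM.hasFDerivAt_tsum_rpow u).add (lpBounded_potCLM.hasFDerivAt_tsum_rpow u)

theorem normRpowDeriv_apply_self (u : HSpace p h hp h₁) : normRpowDeriv u u = p * ‖u‖ ^ p := by
  rw [normRpowDeriv, add_apply, lpBounded_gradCLM.tsumRpowDeriv_apply_self,
    lpBounded_potCLM.tsumRpowDeriv_apply_self, norm_rpow_eq_add, mul_add]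

theorem hasSum_normRpowDeriv_apply (u v : HSpace p h hp h₁) :
    HasSum (fun x => p * (gradNorm u x ^ (p - 2) * gradForm u v x) +
      p * (h x * |u x| ^ (p - 2) * u x * v x)) (normRpowDeriv u v) := by
  refine (((lpBounded_gradCLM (hp := hp) (h₁ := h₁)).hasSum_tsumRpowDeriv_apply u v).add
    (lpBounded_potCLM.hasSum_tsumRpowDeriv_apply u v)).congr_fun fun x => ?_
  have hx := potential_nonneg h₁ x
  have hweight : (h x ^ (1 / p)) ^ (p - 2) * (h x ^ (1 / p)) ^ (2 : ℝ) = h x := by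
    rw [← Real.rpow_add' (by positivity) (by linarith), sub_add_cancel, one_div,
      Real.rpow_inv_rpow hx (by linarith)]
  rw [Real.rpow_two] at hweight
  rw [norm_gradCLM, inner_gradCLM]
  simp only [potCLM_apply, RCLike.inner_apply, conj_trivial, Real.norm_eq_abs]
  rw [abs_mul, abs_of_nonneg (by positivity : 0 ≤ h x ^ (1 / p)),
    Real.mul_rpow (by positivity) (abs_nonneg _)]
  linear_combination -(p * |u x| ^ (p - 2) * u x * v x) * hweight

theorem tendsto_gradCLM {u : ℕ → HSpace p h hp h₁} {v : HSpace p h hp h₁}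
    (hlim : ∀ x, Tendsto (fun n => u n x) atTop (𝓝 (v x))) (x : Fin N → ℤ) :
    Tendsto (fun n => gradCLM hp h₁ x (u n)) atTop (𝓝 (gradCLM hp h₁ x v)) := by
  refine ((EuclideanSpace.equiv (nbrs x) ℝ).symm.continuous.tendsto _).comp
    (tendsto_pi_nhds.2 fun y => ?_)
  simpa using! ((hlim y).sub (hlim x)).const_mul √(1 / 2)

theorem tendsto_norm_rpow_sub {u : ℕ → HSpace p h hp h₁} {v : HSpace p h hp h₁} {M : ℝ}
    (hM : ∀ n, ‖u n‖ ≤ M) (hlim : ∀ x, Tendsto (fun n => u n x) atTop (𝓝 (v x))) :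
    Tendsto (fun n => ‖u n‖ ^ p - ‖u n - v‖ ^ p) atTop (𝓝 (‖v‖ ^ p)) := by
  have hp₀ : 0 < p := by linarith
  have hgrad := lpBounded_gradCLM.tendsto_tsum_sub_tsum (brezisLieb_norm_rpow hp₀) hM
    (tendsto_gradCLM hlim)
  have hpot := lpBounded_potCLM.tendsto_tsum_sub_tsum (brezisLieb_norm_rpow hp₀) hM
    fun x => (hlim x).const_mul (h x ^ (1 / p))
  simp only [norm_rpow_eq_add]
  exact (hgrad.add hpot).congr fun n => by ring

/-! ### Point masses, translations and pointwise limits in `H` -/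

variable (hp h₁) in
/-- The indicator function of a point as an element of `H`. -/
def single (x : Fin N → ℤ) : HSpace p h hp h₁ :=
  ofSummable hp h₁ (Pi.single x 1) <| summable_of_ne_finset_zero (s := {x}) fun y hy => by
    have hp₀ : p ≠ 0 := by linarith
    simp [Pi.single_eq_of_ne (Finset.notMem_singleton.1 hy), Real.zero_rpow hp₀]

theorem coe_single (x : Fin N → ℤ) :
    (single hp h₁ x : (Fin N → ℤ) → ℝ) = Pi.single x 1 := rfl

/-- Translation by a period of `h`. -/
def shift (z : Fin N → ℤ) (hz : ∀ x, h (x + z) = h x) (u : HSpace p h hp h₁) :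
    HSpace p h hp h₁ :=
  ofSummable hp h₁ (fun x => u (x + z)) <| by
    have hs := (Equiv.addRight z).summable_iff.2 u.2.2
    simpa only [Function.comp_def, Equiv.coe_addRight, hz] using hs

variable {z : Fin N → ℤ} {hz : ∀ x, h (x + z) = h x}

@[simp] theorem shift_apply (u : HSpace p h hp h₁) (x : Fin N → ℤ) :
    shift z hz u x = u (x + z) := rfl

theorem norm_shift (u : HSpace p h hp h₁) : ‖shift z hz u‖ = ‖u‖ := by
  have hdens : ∀ x, density p h (shift z hz u) x = density p h u (x + z) := fun x => by
    rw [density, density, hz, shift_apply]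
    congr 2
    exact gradNorm_comp_add_right u x z
  change wnorm p h _ = wnorm p h _
  rw [wnorm, wnorm]
  congr 1
  simp only [hdens]
  exact (Equiv.addRight z).tsum_eq (density p h u)

theorem exists_eq_of_tendsto {u : ℕ → HSpace p h hp h₁} {M : ℝ} (hM : ∀ n, ‖u n‖ ≤ M)
    {a : (Fin N → ℤ) → ℝ} (ha : ∀ x, Tendsto (fun n => u n x) atTop (𝓝 (a x))) :
    ∃ v : HSpace p h hp h₁, ∀ x, v x = a x := by
  have hp₀ : 0 ≤ p := by linarith
  refine ⟨ofSummable hp h₁ a (summable_of_sum_le (c := M ^ p)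
    (fun x => mul_nonneg (potential_nonneg h₁ x) (by positivity)) fun s => ?_), fun x => rfl⟩
  have hlim : Tendsto (fun n => ∑ x ∈ s, h x * |u n x| ^ p) atTop
      (𝓝 (∑ x ∈ s, h x * |a x| ^ p)) :=
    tendsto_finsetSum _ fun x _ => ((ha x).abs.rpow_const (Or.inr hp₀)).const_mul _
  refine le_of_tendsto' hlim fun n => ?_
  have hpot := lpBounded_potCLM.sum_rpow_le (u n) s
  simp only [norm_potCLM_rpow, one_mul] at hpot
  exact hpot.trans (Real.rpow_le_rpow (norm_nonneg _) (hM n) hp₀)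

theorem exists_subseq_tendsto {u : ℕ → HSpace p h hp h₁} {M : ℝ} (hM : ∀ n, ‖u n‖ ≤ M) :
    ∃ (φ : ℕ → ℕ) (v : HSpace p h hp h₁), StrictMono φ ∧
      ∀ x, Tendsto (fun n => u (φ n) x) atTop (𝓝 (v x)) := by
  obtain ⟨B, hB⟩ := exists_lpBounded_eval hp h₁
  have hcomp : IsCompact (Set.univ.pi fun _ : Fin N → ℤ => Set.Icc (-(B * M)) (B * M)) :=
    isCompact_univ_pi fun _ => isCompact_Icc
  obtain ⟨a, -, φ, hφ, hlim⟩ := hcomp.tendsto_subseq (x := fun n => (u n : (Fin N → ℤ) → ℝ))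
    fun n x _ => abs_le.1 <| (hB.norm_apply_le x (u n)).trans <|
      mul_le_mul_of_nonneg_left (hM n) hB.nonneg
  rw [tendsto_pi_nhds] at hlim
  obtain ⟨v, hv⟩ := exists_eq_of_tendsto (fun n => hM (φ n)) hlim
  exact ⟨φ, v, hφ, fun x => (hv x).symm ▸ hlim x⟩

/-- Translating by periods brings a point where `|u|` is large into the fundamental box, so that
the limit cannot vanish. -/
theorem exists_shift_tendsto {T : ℤ} (hT : T ≠ 0) (h₂ : ∀ x k : Fin N → ℤ, h (x + T • k) = h x)
    {u : ℕ → HSpace p h hp h₁} {M δ : ℝ} (hδ : 0 < δ) (hM : ∀ n, ‖u n‖ ≤ M)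
    (hsup : ∀ n, ∃ x, δ < |u n x|) :
    ∃ (φ : ℕ → ℕ) (k : ℕ → Fin N → ℤ) (v : HSpace p h hp h₁), StrictMono φ ∧ v ≠ 0 ∧
      ∀ x, Tendsto (fun n => (u (φ n)).shift (T • k n) (fun x => h₂ x _) x) atTop (𝓝 (v x)) := by
  choose x hx using hsup
  set k : ℕ → Fin N → ℤ := fun n j => x n j / T
  set r : ℕ → Fin N → ℤ := fun n j => x n j % T
  have hdiv : ∀ n, r n + T • k n = x n := fun n => funext fun j => Int.emod_add_mul_ediv _ _
  have hbox : ∀ n, r n ∈ Set.Icc (0 : Fin N → ℤ) fun _ => |T| := fun n =>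
    ⟨fun j => Int.emod_nonneg _ hT, fun j => (Int.emod_lt_abs _ hT).le⟩
  obtain ⟨φ, v, hφ, hlim⟩ := exists_subseq_tendsto
    (u := fun n => (u n).shift (T • k n) fun x => h₂ x _) fun n => (norm_shift _).trans_le (hM n)
  refine ⟨φ, fun n => k (φ n), v, hφ, fun hv => ?_, hlim⟩
  have hsmall : ∀ᶠ n in atTop, ∀ y ∈ Set.Icc (0 : Fin N → ℤ) fun _ => |T|,
      |(u (φ n)).shift (T • k (φ n)) (fun x => h₂ x _) y| < δ := by
    refine (eventually_all_finite (Set.finite_Icc _ _)).2 fun y _ => ?_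
    exact (hlim y).abs.eventually_lt_const (by simpa [hv] using hδ)
  obtain ⟨n, hn⟩ := hsmall.exists
  have hlarge := hn _ (hbox (φ n))
  rw [shift_apply, hdiv] at hlarge
  exact (hx (φ n)).not_gt hlarge

end HSpace

end Space

/-! ### The Nehari manifold of an abstract functional -/

section Nehari

variable {X : Type*} [NormedAddCommGroup X] [NormedSpace ℝ X] {p κ : ℝ} {J A : X → ℝ}
  {D : X → X →L[ℝ] ℝ}

/-- The Nehari manifold of a functional with derivative `D`. -/
def nehariSet (D : X → X →L[ℝ] ℝ) : Set X := {v | v ≠ 0 ∧ D v v = 0}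

/-- The functional `J u - (1/p) ⟨J'(u), u⟩`, written for `⟨J'(u), u⟩ = ‖u‖ ^ p - A u`. It agrees
with `J` on the Nehari manifold. -/
def reduced (p : ℝ) (J A : X → ℝ) (u : X) : ℝ := J u + (A u - ‖u‖ ^ p) / p

/-- The structure of a `C^1` functional `J` to which the Nehari method applies: its derivative `D`
satisfies `⟨D u, u⟩ = ‖u‖ ^ p - A u` with a term `A` that grows along rays faster than `t ^ (p + 1)`
and is controlled by the reduced functional. -/
structure NehariSetting (p κ : ℝ) (J A : X → ℝ) (D : X → X →L[ℝ] ℝ) : Prop where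
  exponent_pos : 0 < p
  continuous : Continuous D
  hasFDerivAt (u : X) : HasFDerivAt J (D u) u
  apply_self (u : X) : D u u = ‖u‖ ^ p - A u
  nonneg (u : X) : 0 ≤ A u
  lt_smul {u : X} (hu : u ≠ 0) {t : ℝ} (ht : 1 < t) : t ^ (p + 1) * A u < A (t • u)
  coercivity_pos : 0 < κ
  le_reduced (u : X) : κ * A u ≤ reduced p J A u

theorem apply_add_smul_lt (hJ : ∀ u, HasFDerivAt J (D u) u) {v φ : X} {s : ℝ} (hs : 0 < s)
    (hneg : ∀ r ∈ Set.Ioo 0 s, D (v + r • φ) φ < 0) : J (v + s • φ) < J v := by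
  have hder (r : ℝ) : HasDerivAt (fun r : ℝ => J (v + r • φ)) (D (v + r • φ) φ) r :=
    (hJ _).comp_hasDerivAt r <| by simpa using ((hasDerivAt_id r).smul_const φ).const_add v
  have hanti : StrictAntiOn (fun r : ℝ => J (v + r • φ)) (Set.Icc 0 s) := by
    refine strictAntiOn_of_deriv_neg (convex_Icc 0 s)
      (fun r _ => (hder r).continuousAt.continuousWithinAt) fun r hr => ?_
    rw [interior_Icc] at hr
    rw [(hder r).deriv]
    exact hneg r hr
  simpa using hanti (Set.left_mem_Icc.2 hs.le) (Set.right_mem_Icc.2 hs.le) hs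

theorem exists_forall_apply_neg (hD : Continuous D) {u φ : X} (hu : u ≠ 0) (hφ : D u φ < 0) :
    ∃ η ∈ Set.Ioo (0 : ℝ) 1, ∀ t s : ℝ, |t - 1| ≤ η → |s| ≤ η →
      D (t • u + s • φ) φ < 0 ∧ t • u + s • φ ≠ 0 := by
  have hcw : Continuous fun q : ℝ × ℝ => q.1 • u + q.2 • φ := by fun_prop
  have hcφ : Continuous fun q : ℝ × ℝ => D (q.1 • u + q.2 • φ) φ :=
    (hD.comp hcw).clm_apply continuous_const
  have hev : ∀ᶠ q : ℝ × ℝ in 𝓝 (1, 0),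
      D (q.1 • u + q.2 • φ) φ < 0 ∧ q.1 • u + q.2 • φ ≠ 0 :=
    ((hcφ.tendsto _).eventually_lt_const (by simpa using hφ)).and
      ((hcw.tendsto _).eventually_ne (by simpa using hu))
  obtain ⟨δ, hδ, H⟩ := Metric.eventually_nhds_iff.1 hev
  have hηδ : min (δ / 2) (1 / 2) < δ := (min_le_left _ _).trans_lt (half_lt_self hδ)
  refine ⟨min (δ / 2) (1 / 2), ⟨by positivity, (min_le_right _ _).trans_lt (by norm_num)⟩,
    fun t s ht hs => H (y := (t, s)) ?_⟩
  rw [Prod.dist_eq, max_lt_iff]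
  exact ⟨ht.trans_lt hηδ, by simpa using hs.trans_lt hηδ⟩

theorem exists_apply_self_eq_zero_near (hD : Continuous D) {u φ : X}
    (hpos : ∀ t : ℝ, 0 < t → t < 1 → 0 < D (t • u) (t • u))
    (hneg : ∀ t : ℝ, 1 < t → D (t • u) (t • u) < 0) {η : ℝ} (hη : η ∈ Set.Ioo (0 : ℝ) 1) :
    ∃ s ∈ Set.Ioo 0 η, ∃ t : ℝ, |t - 1| ≤ η ∧ D (t • u + s • φ) (t • u + s • φ) = 0 := by
  have hcw : Continuous fun q : ℝ × ℝ => q.1 • u + q.2 • φ := by fun_prop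
  have hcg : Continuous fun q : ℝ × ℝ => D (q.1 • u + q.2 • φ) (q.1 • u + q.2 • φ) :=
    (hD.comp hcw).clm_apply hcw
  have hcs (t : ℝ) : Tendsto (fun s : ℝ => D (t • u + s • φ) (t • u + s • φ)) (𝓝[>] 0)
      (𝓝 (D (t • u) (t • u))) := by
    have hc : Continuous fun s : ℝ => D (t • u + s • φ) (t • u + s • φ) :=
      hcg.comp (Continuous.prodMk_right t)
    simpa using (hc.tendsto 0).mono_left nhdsWithin_le_nhds
  obtain ⟨s, hs1, hs2, hs⟩ :=
    (((hcs (1 - η)).eventually_const_lt (hpos _ (by linarith [hη.2]) (by linarith [hη.1]))).and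
      (((hcs (1 + η)).eventually_lt_const (hneg _ (by linarith [hη.1]))).and
        (Ioo_mem_nhdsGT hη.1))).exists
  have hct : Continuous fun t : ℝ => D (t • u + s • φ) (t • u + s • φ) :=
    hcg.comp (Continuous.prodMk_left s)
  obtain ⟨t, ht, h0⟩ :=
    intermediate_value_Icc' (by linarith [hη.1]) hct.continuousOn ⟨hs2.le, hs1.le⟩
  exact ⟨s, hs, t, abs_le.2 ⟨by linarith [ht.1], by linarith [ht.2]⟩, h0⟩

/-- If `D u φ < 0`, a zero of `⟨D v, v⟩` close to `u` on a parallel to the ray, displaced by a small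
multiple of `φ`, has lower energy than the maximum of `J` along the ray. -/
theorem eq_zero_of_forall_nehariSet_le (hD : Continuous D) (hJ : ∀ u, HasFDerivAt J (D u) u) {u : X}
    (hu : u ≠ 0) (hmin : ∀ v ∈ nehariSet D, J u ≤ J v) (hmax : ∀ t : ℝ, 0 < t → J (t • u) ≤ J u)
    (hpos : ∀ t : ℝ, 0 < t → t < 1 → 0 < D (t • u) (t • u))
    (hneg : ∀ t : ℝ, 1 < t → D (t • u) (t • u) < 0) : D u = 0 := by
  by_contra hne
  obtain ⟨φ, hφ⟩ : ∃ φ, D u φ < 0 := by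
    obtain ⟨ψ, hψ⟩ : ∃ ψ, D u ψ ≠ 0 := DFunLike.ne_iff.1 hne
    rcases lt_or_gt_of_ne hψ with hψ | hψ
    · exact ⟨ψ, hψ⟩
    · exact ⟨-ψ, by simpa using hψ⟩
  obtain ⟨η, hη, H⟩ := exists_forall_apply_neg hD hu hφ
  obtain ⟨s, hs, t, ht, h0⟩ := exists_apply_self_eq_zero_near (φ := φ) hD hpos hneg hη
  have hlt : J (t • u + s • φ) < J (t • u) := apply_add_smul_lt hJ hs.1 fun r hr =>
    (H t r ht (by rw [abs_of_pos hr.1]; exact (hr.2.trans hs.2).le)).1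
  have hle : J u ≤ J (t • u + s • φ) :=
    hmin _ ⟨(H t s ht (by rw [abs_of_pos hs.1]; exact hs.2.le)).2, h0⟩
  have ht0 : 0 < t := by linarith [(abs_le.1 ht).1, hη.2]
  exact (hlt.trans_le (hmax t ht0)).not_ge hle

namespace NehariSetting

theorem pos (hN : NehariSetting p κ J A D) {u : X} (hu : u ≠ 0) : 0 < A u := by
  have hlt := hN.lt_smul (smul_ne_zero (inv_ne_zero (two_ne_zero (α := ℝ))) hu) one_lt_two
  rw [smul_inv_smul₀ two_ne_zero] at hlt
  exact lt_of_le_of_lt (mul_nonneg (by positivity) (hN.nonneg _)) hlt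

theorem smul_lt (hN : NehariSetting p κ J A D) {u : X} (hu : u ≠ 0) {t : ℝ} (ht : 0 < t)
    (ht1 : t < 1) : A (t • u) < t ^ (p + 1) * A u := by
  have hlt := hN.lt_smul (smul_ne_zero ht.ne' hu) ((one_lt_inv₀ ht).2 ht1)
  rwa [inv_smul_smul₀ ht.ne', Real.inv_rpow ht.le, inv_mul_lt_iff₀ (by positivity)] at hlt

theorem apply_zero (hN : NehariSetting p κ J A D) : A 0 = 0 := by
  have h0 := hN.apply_self 0
  rw [map_zero, norm_zero, Real.zero_rpow hN.exponent_pos.ne'] at h0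
  linarith

theorem norm_rpow_eq (hN : NehariSetting p κ J A D) {u : X} (hu : u ∈ nehariSet D) :
    ‖u‖ ^ p = A u := by
  rw [← sub_eq_zero, ← hN.apply_self, hu.2]

theorem eq_reduced (hN : NehariSetting p κ J A D) {u : X} (hu : u ∈ nehariSet D) :
    J u = reduced p J A u := by
  rw [reduced, hN.norm_rpow_eq hu, sub_self, zero_div, add_zero]

theorem reduced_nonneg (hN : NehariSetting p κ J A D) (u : X) : 0 ≤ reduced p J A u :=
  (mul_nonneg hN.coercivity_pos.le (hN.nonneg u)).trans (hN.le_reduced u)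

theorem apply_smul_self (hN : NehariSetting p κ J A D) (u : X) {t : ℝ} (ht : 0 < t) :
    D (t • u) (t • u) = t ^ p * ‖u‖ ^ p - A (t • u) := by
  rw [hN.apply_self, norm_smul, Real.norm_of_nonneg ht.le, Real.mul_rpow ht.le (norm_nonneg _)]

theorem apply_smul_self_pos (hN : NehariSetting p κ J A D) {u : X} (hu : u ≠ 0) {t : ℝ}
    (ht : 0 < t) (ht1 : t < 1) (htA : t * A u ≤ ‖u‖ ^ p) : 0 < D (t • u) (t • u) := by
  rw [hN.apply_smul_self u ht, sub_pos]
  calc A (t • u) < t ^ (p + 1) * A u := hN.smul_lt hu ht ht1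
    _ = t ^ p * (t * A u) := by rw [Real.rpow_add_one ht.ne', mul_assoc]
    _ ≤ t ^ p * ‖u‖ ^ p := by gcongr

theorem apply_smul_self_neg (hN : NehariSetting p κ J A D) {u : X} (hu : u ≠ 0) {t : ℝ}
    (ht1 : 1 < t) (htA : ‖u‖ ^ p ≤ t * A u) : D (t • u) (t • u) < 0 := by
  have ht : 0 < t := one_pos.trans ht1
  rw [hN.apply_smul_self u ht, sub_neg]
  calc t ^ p * ‖u‖ ^ p ≤ t ^ p * (t * A u) := by gcongr
    _ = t ^ (p + 1) * A u := by rw [Real.rpow_add_one ht.ne', mul_assoc]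
    _ < A (t • u) := hN.lt_smul hu ht1

theorem exists_smul_mem (hN : NehariSetting p κ J A D) {u : X} (hu : u ≠ 0) :
    ∃ t : ℝ, 0 < t ∧ t • u ∈ nehariSet D := by
  have hA := hN.pos hu
  have hc : Continuous fun t : ℝ => D (t • u) (t • u) :=
    (hN.continuous.comp (by fun_prop)).clm_apply (by fun_prop)
  set r := ‖u‖ ^ p / A u
  have hr0 : 0 < r := div_pos (Real.rpow_pos_of_pos (norm_pos_iff.2 hu) p) hA
  set a := min 2⁻¹ r
  set b := max 2 r
  have ha : 0 < a := lt_min (by norm_num) hr0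
  have hab : a ≤ b := (min_le_right _ _).trans (le_max_right _ _)
  have hDa : 0 < D (a • u) (a • u) :=
    hN.apply_smul_self_pos hu ha ((min_le_left _ _).trans_lt (by norm_num))
      ((le_div_iff₀ hA).1 (min_le_right _ _))
  have hDb : D (b • u) (b • u) < 0 :=
    hN.apply_smul_self_neg hu (one_lt_two.trans_le (le_max_left _ _))
      ((div_le_iff₀ hA).1 (le_max_right _ _))
  obtain ⟨t, ht, h0⟩ := intermediate_value_Icc' hab hc.continuousOn ⟨hDb.le, hDa.le⟩
  have ht0 : 0 < t := ha.trans_le ht.1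
  exact ⟨t, ht0, smul_ne_zero ht0.ne' hu, h0⟩

theorem hasDerivAt_ray (hN : NehariSetting p κ J A D) (u : X) {t : ℝ} (ht : 0 < t) :
    HasDerivAt (fun t : ℝ => (A u - ‖u‖ ^ p) / p * t ^ p + J (t • u))
      ((t ^ p * A u - A (t • u)) / t) t := by
  have hp := hN.exponent_pos
  have hDu : t * D (t • u) u = t ^ p * ‖u‖ ^ p - A (t • u) := by
    rw [← hN.apply_smul_self u ht, map_smul, smul_eq_mul]
  have hJ : HasDerivAt (fun t : ℝ => J (t • u)) (D (t • u) u) t :=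
    (hN.hasFDerivAt _).comp_hasDerivAt t <| by simpa using (hasDerivAt_id t).smul_const u
  refine (((Real.hasDerivAt_rpow_const (p := p) (Or.inl ht.ne')).const_mul
    ((A u - ‖u‖ ^ p) / p)).add hJ).congr_deriv ?_
  rw [Real.rpow_sub_one ht.ne']
  field_simp
  linarith

theorem ray_le (hN : NehariSetting p κ J A D) {u : X} (hu : u ≠ 0) {t : ℝ} (ht : 0 < t) :
    (A u - ‖u‖ ^ p) / p * t ^ p + J (t • u) ≤ reduced p J A u := by
  set ψ : ℝ → ℝ := fun t => (A u - ‖u‖ ^ p) / p * t ^ p + J (t • u) with hψ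
  have hder {s : ℝ} (hs : 0 < s) := hN.hasDerivAt_ray u hs
  have hψ1 : ψ 1 = reduced p J A u := by
    simp only [hψ, reduced, Real.one_rpow, mul_one, one_smul, add_comm]
  change ψ t ≤ _
  rw [← hψ1]
  rcases le_total t 1 with h | h
  · have hm : MonotoneOn ψ (Set.Icc t 1) := by
      refine monotoneOn_of_hasDerivWithinAt_nonneg (convex_Icc t 1)
        (fun s hs => (hder (ht.trans_le hs.1)).continuousAt.continuousWithinAt)
        (fun s hs => (hder ?_).hasDerivWithinAt) fun s hs => ?_
      all_goals rw [interior_Icc] at hs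
      · exact ht.trans hs.1
      · have hs0 : 0 < s := ht.trans hs.1
        refine div_nonneg (sub_nonneg.2 ((hN.smul_lt hu hs0 hs.2).le.trans ?_)) hs0.le
        exact mul_le_mul_of_nonneg_right (Real.rpow_le_rpow_of_exponent_ge hs0 hs.2.le
          (le_add_of_nonneg_right zero_le_one)) (hN.nonneg u)
    exact hm (Set.left_mem_Icc.2 h) (Set.right_mem_Icc.2 h) h
  · have hm : AntitoneOn ψ (Set.Icc 1 t) := by
      refine antitoneOn_of_hasDerivWithinAt_nonpos (convex_Icc 1 t)
        (fun s hs => (hder (one_pos.trans_le hs.1)).continuousAt.continuousWithinAt)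
        (fun s hs => (hder ?_).hasDerivWithinAt) fun s hs => ?_
      all_goals rw [interior_Icc] at hs
      · exact one_pos.trans hs.1
      · refine div_nonpos_of_nonpos_of_nonneg
          (sub_nonpos.2 (le_trans ?_ (hN.lt_smul hu hs.1).le)) (one_pos.trans hs.1).le
        exact mul_le_mul_of_nonneg_right (Real.rpow_le_rpow_of_exponent_le hs.1.le
          (le_add_of_nonneg_right zero_le_one)) (hN.nonneg u)
    exact hm (Set.left_mem_Icc.2 h) (Set.right_mem_Icc.2 h) h

theorem eq_zero_of_isLeast (hN : NehariSetting p κ J A D) {u : X} (hu : u ∈ nehariSet D)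
    (hmin : IsLeast (J '' nehariSet D) (J u)) : D u = 0 := by
  have hA := hN.norm_rpow_eq hu
  refine eq_zero_of_forall_nehariSet_le hN.continuous hN.hasFDerivAt hu.1
    (fun v hv => hmin.2 (Set.mem_image_of_mem J hv)) (fun t ht => ?_) (fun t ht ht1 => ?_)
    fun t ht1 => ?_
  · simpa only [hA, sub_self, zero_div, zero_mul, zero_add, ← hN.eq_reduced hu]
      using hN.ray_le hu.1 ht
  · refine hN.apply_smul_self_pos hu.1 ht ht1 ?_
    rw [hA]
    exact mul_le_of_le_one_left (hN.nonneg u) ht1.le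
  · refine hN.apply_smul_self_neg hu.1 ht1 ?_
    rw [hA]
    exact le_mul_of_one_le_left (hN.nonneg u) ht1.le

theorem bddBelow (hN : NehariSetting p κ J A D) : BddBelow (J '' nehariSet D) := by
  refine ⟨0, ?_⟩
  rintro _ ⟨v, hv, rfl⟩
  rw [hN.eq_reduced hv]
  exact hN.reduced_nonneg v

theorem exists_sInf_add_le_reduced (hN : NehariSetting p κ J A D) {u : X} (hu : u ≠ 0) :
    ∃ t : ℝ, 0 < t ∧ sInf (J '' nehariSet D) + (A u - ‖u‖ ^ p) / p * t ^ p ≤ reduced p J A u := by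
  obtain ⟨t, ht, hmem⟩ := hN.exists_smul_mem hu
  have hle := csInf_le hN.bddBelow (Set.mem_image_of_mem J hmem)
  exact ⟨t, ht, by linarith [hN.ray_le hu ht]⟩

theorem exists_bounded_seq_tendsto_sInf [Nontrivial X] (hN : NehariSetting p κ J A D) :
    ∃ (u : ℕ → X) (M : ℝ), (∀ n, u n ∈ nehariSet D) ∧ (∀ n, ‖u n‖ ≤ M) ∧
      Tendsto (fun n => reduced p J A (u n)) atTop (𝓝 (sInf (J '' nehariSet D))) := by
  obtain ⟨z, hz⟩ := exists_ne (0 : X)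
  obtain ⟨t, -, htz⟩ := hN.exists_smul_mem hz
  obtain ⟨s, -, hlim, hmem⟩ := exists_seq_tendsto_sInf (Set.Nonempty.image J ⟨_, htz⟩) hN.bddBelow
  choose u hu hus using hmem
  obtain rfl : (fun n => reduced p J A (u n)) = s :=
    funext fun n => by rw [← hN.eq_reduced (hu n), hus]
  obtain ⟨c, hc⟩ := hlim.bddAbove_range
  refine ⟨u, (c / κ) ^ p⁻¹, hu, fun n => ?_, hlim⟩
  have hle : ‖u n‖ ^ p ≤ c / κ := by
    rw [le_div_iff₀' hN.coercivity_pos, hN.norm_rpow_eq (hu n)]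
    exact (hN.le_reduced _).trans (hc ⟨n, rfl⟩)
  exact (Real.le_rpow_inv_iff_of_pos (norm_nonneg _) (le_trans (by positivity) hle)
    hN.exponent_pos).2 hle

/-- If `A v < ‖v‖ ^ p`, then `w n - v` lies beyond the Nehari manifold for large `n`, so its reduced
energy is at least the infimum, and nothing would be left for `v`. -/
theorem norm_rpow_le_of_splitting (hN : NehariSetting p κ J A D) {w : ℕ → X} {v : X} (hv : v ≠ 0)
    (hlimI : Tendsto (fun n => ‖w n - v‖ ^ p - A (w n - v)) atTop (𝓝 (A v - ‖v‖ ^ p)))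
    (hlimG : Tendsto (fun n => reduced p J A (w n - v)) atTop
      (𝓝 (sInf (J '' nehariSet D) - reduced p J A v))) : ‖v‖ ^ p ≤ A v := by
  by_contra! hlt
  have hev : ∀ᶠ n in atTop, sInf (J '' nehariSet D) ≤ reduced p J A (w n - v) := by
    filter_upwards [hlimI.eventually_lt_const (sub_neg.2 hlt)] with n hn
    have hne : w n - v ≠ 0 := fun h0 => by
      rw [h0, norm_zero, Real.zero_rpow hN.exponent_pos.ne', hN.apply_zero, sub_self] at hn
      exact lt_irrefl _ hn
    obtain ⟨t, ht, hle⟩ := hN.exists_sInf_add_le_reduced hne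
    have hnn : 0 ≤ (A (w n - v) - ‖w n - v‖ ^ p) / p * t ^ p :=
      mul_nonneg (div_nonneg (by linarith) hN.exponent_pos.le) (by positivity)
    linarith
  have hGv : 0 < reduced p J A v :=
    (mul_pos hN.coercivity_pos (hN.pos hv)).trans_le (hN.le_reduced v)
  linarith [ge_of_tendsto hlimG hev]

theorem isLeast_of_splitting (hN : NehariSetting p κ J A D) {w : ℕ → X} {v : X} (hv : v ≠ 0)
    (hw : ∀ n, w n ∈ nehariSet D)
    (hlim : Tendsto (fun n => reduced p J A (w n)) atTop (𝓝 (sInf (J '' nehariSet D))))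
    (hnorm : Tendsto (fun n => ‖w n‖ ^ p - ‖w n - v‖ ^ p) atTop (𝓝 (‖v‖ ^ p)))
    (hA : Tendsto (fun n => A (w n) - A (w n - v)) atTop (𝓝 (A v)))
    (hG : Tendsto (fun n => reduced p J A (w n) - reduced p J A (w n - v)) atTop
      (𝓝 (reduced p J A v))) :
    v ∈ nehariSet D ∧ IsLeast (J '' nehariSet D) (J v) := by
  have hlimI : Tendsto (fun n => ‖w n - v‖ ^ p - A (w n - v)) atTop (𝓝 (A v - ‖v‖ ^ p)) :=
    (hA.sub hnorm).congr fun n => by rw [hN.norm_rpow_eq (hw n)]; ring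
  have hlimG : Tendsto (fun n => reduced p J A (w n - v)) atTop
      (𝓝 (sInf (J '' nehariSet D) - reduced p J A v)) := by
    simpa only [sub_sub_cancel] using hlim.sub hG
  have hle : ‖v‖ ^ p ≤ A v := hN.norm_rpow_le_of_splitting hv hlimI hlimG
  have hGle : reduced p J A v ≤ sInf (J '' nehariSet D) :=
    sub_nonneg.1 (ge_of_tendsto' hlimG fun n => hN.reduced_nonneg _)
  have hmem : v ∈ nehariSet D := by
    obtain ⟨t, ht, hproj⟩ := hN.exists_sInf_add_le_reduced hv
    refine ⟨hv, ?_⟩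
    rw [hN.apply_self, sub_eq_zero]
    refine hle.antisymm (not_lt.1 fun hlt => ?_)
    have hpos : 0 < (A v - ‖v‖ ^ p) / p * t ^ p :=
      mul_pos (div_pos (sub_pos.2 hlt) hN.exponent_pos) (by positivity)
    linarith
  refine ⟨hmem, Set.mem_image_of_mem J hmem, fun _ hy => ?_⟩
  rw [hN.eq_reduced hmem]
  exact hGle.trans (csInf_le hN.bddBelow hy)

end NehariSetting

end Nehari

/-! ### The energy of the Choquard equation -/

section Energy

variable {N : ℕ} {p : ℝ} {h : (Fin N → ℤ) → ℝ} {hp : 2 ≤ p} {h₁ : ∃ h₀ > 0, ∀ x, h₀ ≤ h x}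
  {V : Type*} [NormedAddCommGroup V] [InnerProductSpace ℝ V] {α θ κ : ℝ} {e : (Fin N → ℤ) → V}
  {f j k : ℝ → ℝ}

/-- The nonlocal term `∑ (R_α ∗ F(u)) f(u) u` of `⟨J'(u), u⟩`, where `e` has Gram matrix `R_α`. -/
def coupling (e : (Fin N → ℤ) → V) (f : ℝ → ℝ) (u : (Fin N → ℤ) → ℝ) : ℝ :=
  inner ℝ (superpos e (primitive f) u) (superpos e (fun t => f t * t) u)

/-- The derivative of the energy at `u`. -/
def energyDeriv (e : (Fin N → ℤ) → V) (f : ℝ → ℝ) (u : HSpace p h hp h₁) :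
    HSpace p h hp h₁ →L[ℝ] ℝ :=
  (1 / p) • HSpace.normRpowDeriv u -
    (innerSL ℝ (superpos e (primitive f) u)).comp (superposDeriv (HSpace.eval hp h₁) e f u)

theorem norm_eq_norm_zero (he : ∀ x y, inner ℝ (e x) (e y) = green α x y) (x : Fin N → ℤ) :
    ‖e x‖ = ‖e 0‖ := by
  rw [norm_eq_sqrt_real_inner, norm_eq_sqrt_real_inner, he, he]
  simpa only [zero_add] using congrArg Real.sqrt (green_add_right α 0 0 x)

theorem HSpace.summable_abs_comp (hk : IsSmallPow p k) (u : HSpace p h hp h₁) :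
    Summable fun x => |k (u x)| :=
  let ⟨_, hL⟩ := exists_lpBounded_eval hp h₁
  hL.summable_abs_comp hk u

theorem greenConv_nonneg (hα : 0 < α) (hαN : α < N) {g : (Fin N → ℤ) → ℝ} (hg : ∀ y, 0 ≤ g y)
    (x : Fin N → ℤ) : 0 ≤ greenConv α g x :=
  tsum_nonneg fun y => mul_nonneg (green_nonneg hα hαN x y) (hg y)

theorem greenConv_comp_add_right (g : (Fin N → ℤ) → ℝ) (z x : Fin N → ℤ) :
    greenConv α (fun y => g (y + z)) x = greenConv α g (x + z) := by
  rw [greenConv, greenConv, ← (Equiv.addRight z).tsum_eq fun y => green α (x + z) y * g y]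
  simp only [Equiv.coe_addRight, green_add_right]

theorem energyDeriv_apply (u v : HSpace p h hp h₁) :
    energyDeriv e f u v = 1 / p * HSpace.normRpowDeriv u v -
      inner ℝ (superpos e (primitive f) u) (superposDeriv (HSpace.eval hp h₁) e f u v) := by
  simp only [energyDeriv, FunLike.coe_sub, Pi.sub_apply, FunLike.coe_smul, Pi.smul_apply,
    ContinuousLinearMap.comp_apply, innerSL_apply_apply, smul_eq_mul]

instance : Nontrivial (HSpace p h hp h₁) where
  exists_pair_ne := by
    refine ⟨HSpace.single hp h₁ 0, 0, fun hs => one_ne_zero (α := ℝ) ?_⟩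
    rw [← Pi.single_eq_same (M := fun _ : Fin N → ℤ => ℝ) 0 1]
    exact congrArg (HSpace.eval hp h₁ 0) hs

section Complete

variable [CompleteSpace V]

theorem inner_superpos_apply (he : ∀ x y, inner ℝ (e x) (e y) = green α x y)
    (hk : IsSmallPow p k) (u : HSpace p h hp h₁) (x : Fin N → ℤ) :
    inner ℝ (superpos e k u) (e x) = greenConv α (fun y => k (u y)) x := by
  rw [← (hasSum_inner_superpos (u.summable_abs_comp hk) (fun y => (norm_eq_norm_zero he y).le)
    (e x)).tsum_eq, greenConv]
  refine tsum_congr fun y => ?_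
  rw [real_inner_comm, he, mul_comm]

theorem hasSum_greenConv_mul (he : ∀ x y, inner ℝ (e x) (e y) = green α x y)
    (hj : IsSmallPow p j) (hk : IsSmallPow p k) (u : HSpace p h hp h₁) :
    HasSum (fun x => greenConv α (fun y => j (u y)) x * k (u x))
      (inner ℝ (superpos e j u) (superpos e k u)) := by
  rw [real_inner_comm]
  refine (hasSum_inner_superpos (u.summable_abs_comp hk)
    (fun y => (norm_eq_norm_zero he y).le) _).congr_fun fun x => ?_
  rw [real_inner_comm, inner_superpos_apply he hj, mul_comm]

theorem inner_superpos_shift (he : ∀ x y, inner ℝ (e x) (e y) = green α x y)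
    (hj : IsSmallPow p j) (hk : IsSmallPow p k) {z : Fin N → ℤ} (hz : ∀ x, h (x + z) = h x)
    (u : HSpace p h hp h₁) :
    inner ℝ (superpos e j (u.shift z hz)) (superpos e k (u.shift z hz)) =
      inner ℝ (superpos e j u) (superpos e k u) := by
  rw [← (hasSum_greenConv_mul he hj hk _).tsum_eq, ← (hasSum_greenConv_mul he hj hk u).tsum_eq,
    ← (Equiv.addRight z).tsum_eq fun x => greenConv α (fun y => j (u y)) x * k (u x)]
  simp only [HSpace.shift_apply, Equiv.coe_addRight,
    greenConv_comp_add_right (fun y => j (u y))]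

theorem energy_eq (he : ∀ x y, inner ℝ (e x) (e y) = green α x y) (hf : IsSmallPow (p - 1) f)
    (u : HSpace p h hp h₁) :
    energy α f u = 1 / p * ‖u‖ ^ p - 1 / 2 * ‖superpos e (primitive f) u‖ ^ 2 := by
  have hF := hf.primitive (by linarith : 1 < p)
  rw [energy, ← real_inner_self_eq_norm_sq, ← (hasSum_greenConv_mul he hF hF u).tsum_eq,
    HSpace.norm_rpow]
  rfl

theorem hasFDerivAt_energy (he : ∀ x y, inner ℝ (e x) (e y) = green α x y)
    (hf : IsSmallPow (p - 1) f) (u : HSpace p h hp h₁) :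
    HasFDerivAt (energy α f) (energyDeriv e f u) u := by
  obtain ⟨B, hL⟩ := HSpace.exists_lpBounded_eval hp h₁
  have hS := hL.hasFDerivAt_superpos hf (fun x => (norm_eq_norm_zero he x).le) u
  have hE := ((HSpace.hasFDerivAt_norm_rpow u).const_mul (1 / p)).sub (hS.norm_sq.const_mul (1 / 2))
  refine (hE.congr_fderiv ?_).congr_of_eventuallyEq (.of_forall fun w => energy_eq he hf w)
  ext v
  simp [energyDeriv]

theorem continuous_energyDeriv (he : ∀ x y, inner ℝ (e x) (e y) = green α x y)
    (hf : IsSmallPow (p - 1) f) :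
    Continuous (energyDeriv e f : HSpace p h hp h₁ → HSpace p h hp h₁ →L[ℝ] ℝ) := by
  obtain ⟨B, hL⟩ := HSpace.exists_lpBounded_eval hp h₁
  have he' : ∀ x, ‖e x‖ ≤ ‖e 0‖ := fun x => (norm_eq_norm_zero he x).le
  have hS : Continuous fun u : HSpace p h hp h₁ => superpos e (primitive f) u :=
    continuous_iff_continuousAt.2 fun u => (hL.hasFDerivAt_superpos hf he' u).continuousAt
  exact (HSpace.continuous_normRpowDeriv.fun_const_smul (1 / p)).sub
    (((innerSL ℝ).continuous.comp hS).clm_comp (hL.continuous_superposDeriv hf he'))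

theorem energyDeriv_apply_self (he : ∀ x y, inner ℝ (e x) (e y) = green α x y)
    (hf : IsSmallPow (p - 1) f) (u : HSpace p h hp h₁) :
    energyDeriv e f u u = ‖u‖ ^ p - coupling e f u := by
  obtain ⟨B, hL⟩ := HSpace.exists_lpBounded_eval hp h₁
  have hS : superposDeriv (HSpace.eval hp h₁) e f u u = superpos e (fun t => f t * t) u :=
    (hL.hasSum_superposDeriv_apply hf (fun x => (norm_eq_norm_zero he x).le) u u).tsum_eq.symm
  have hp₀ : p ≠ 0 := by linarith
  rw [energyDeriv_apply, HSpace.normRpowDeriv_apply_self, hS, coupling, one_div,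
    inv_mul_cancel_left₀ hp₀]

theorem energyDeriv_apply_single (he : ∀ x y, inner ℝ (e x) (e y) = green α x y)
    (hf : IsSmallPow (p - 1) f) (u : HSpace p h hp h₁) (x : Fin N → ℤ) :
    energyDeriv e f u (HSpace.single hp h₁ x) = -pLaplacian p u x + h x * |u x| ^ (p - 2) * u x -
      greenConv α (fun y => primitive f (u y)) x * f (u x) := by
  obtain ⟨B, hL⟩ := HSpace.exists_lpBounded_eval hp h₁
  have hp₀ : p ≠ 0 := by linarith
  have hnorm : HSpace.normRpowDeriv u (HSpace.single hp h₁ x) =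
      p * -pLaplacian p u x + p * (h x * |u x| ^ (p - 2) * u x) := by
    refine (HSpace.hasSum_normRpowDeriv_apply u _).unique
      (((hasSum_gradForm_single p u x).mul_left p).add ?_)
    convert hasSum_single x fun y (hy : y ≠ x) => ?_ using 1
    · rw [HSpace.coe_single, Pi.single_eq_same, mul_one]
    · rw [HSpace.coe_single, Pi.single_eq_of_ne hy, mul_zero, mul_zero]
  have hS : superposDeriv (HSpace.eval hp h₁) e f u (HSpace.single hp h₁ x) = f (u x) • e x := by
    refine (hL.hasSum_superposDeriv_apply hf (fun y => (norm_eq_norm_zero he y).le) u _).unique ?_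
    convert hasSum_single x fun y (hy : y ≠ x) => ?_ using 1
    · rw [HSpace.eval_apply, HSpace.eval_apply, HSpace.coe_single, Pi.single_eq_same, mul_one]
    · rw [HSpace.eval_apply (hp := hp) (h₁ := h₁) y (HSpace.single hp h₁ x), HSpace.coe_single,
        Pi.single_eq_of_ne hy, mul_zero, zero_smul]
  rw [energyDeriv_apply, hnorm, hS, inner_smul_right,
    inner_superpos_apply he (hf.primitive (by linarith))]
  field_simp

theorem le_coupling (hα : 0 < α) (hαN : α < N) (he : ∀ x y, inner ℝ (e x) (e y) = green α x y)
    (hf : IsSmallPow (p - 1) f) (hθ : 0 < θ)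
    (f₃ : ∀ t, 0 ≤ θ * primitive f t ∧ θ * primitive f t ≤ 2 * f t * t) (u : HSpace p h hp h₁) :
    θ / 2 * ‖superpos e (primitive f) u‖ ^ 2 ≤ coupling e f u := by
  have hp1 : 1 < p := by linarith
  have hF := hf.primitive hp1
  rw [← real_inner_self_eq_norm_sq]
  refine hasSum_le (fun x => ?_) ((hasSum_greenConv_mul he hF hF u).mul_left (θ / 2))
    (hasSum_greenConv_mul he hF (hf.mul_id hp1) u)
  have hnn := greenConv_nonneg hα hαN (g := fun y => primitive f (u y))
    (fun y => nonneg_of_mul_nonneg_right (f₃ (u y)).1 hθ) x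
  rw [mul_left_comm]
  exact mul_le_mul_of_nonneg_left (by linarith [(f₃ (u x)).2]) hnn

theorem coupling_smul (he : ∀ x y, inner ℝ (e x) (e y) = green α x y)
    (hf : IsSmallPow (p - 1) f) (u : HSpace p h hp h₁) (t : ℝ) :
    coupling e f (t • u : HSpace p h hp h₁) =
      t * ∑' x, greenConv α (fun y => primitive f (t * u y)) x * f (t * u x) * u x := by
  have hp1 : 1 < p := by linarith
  rw [coupling, ← (hasSum_greenConv_mul he (hf.primitive hp1) (hf.mul_id hp1) (t • u)).tsum_eq,
    ← tsum_mul_left]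
  refine tsum_congr fun x => ?_
  simp only [HSpace.smul_apply]
  ring

theorem lt_coupling_smul (he : ∀ x y, inner ℝ (e x) (e y) = green α x y)
    (hf : IsSmallPow (p - 1) f) {u : HSpace p h hp h₁}
    (f₄ : StrictMonoOn (fun t : ℝ =>
      (∑' x, greenConv α (fun y => primitive f (t * u y)) x * f (t * u x) * u x) / t ^ p)
      (Set.Ioi 0)) {t : ℝ} (ht : 1 < t) :
    t ^ (p + 1) * coupling e f u < coupling e f (t • u : HSpace p h hp h₁) := by
  have ht0 : 0 < t := one_pos.trans ht
  have hlt := f₄ (Set.mem_Ioi.2 one_pos) (Set.mem_Ioi.2 ht0) ht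
  have hone := coupling_smul he hf u 1
  rw [one_smul, one_mul] at hone
  simp only [Real.one_rpow, div_one] at hlt
  rw [← hone, lt_div_iff₀ (by positivity)] at hlt
  rw [coupling_smul he hf u t, Real.rpow_add_one ht0.ne', mul_comm _ t, mul_assoc, mul_comm (t ^ p)]
  exact mul_lt_mul_of_pos_left hlt ht0

theorem reduced_energy (he : ∀ x y, inner ℝ (e x) (e y) = green α x y)
    (hf : IsSmallPow (p - 1) f) (u : HSpace p h hp h₁) :
    reduced p (energy α f) (fun u : HSpace p h hp h₁ => coupling e f u) u =
      1 / p * coupling e f u - 1 / 2 * ‖superpos e (primitive f) u‖ ^ 2 := by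
  rw [reduced, energy_eq he hf]
  ring

theorem nehariSetting_energy (hα : 0 < α) (hαN : α < N)
    (he : ∀ x y, inner ℝ (e x) (e y) = green α x y) (hf : IsSmallPow (p - 1) f) (hθ : p < θ)
    (f₃ : ∀ t, 0 ≤ θ * primitive f t ∧ θ * primitive f t ≤ 2 * f t * t)
    (f₄ : ∀ u : HSpace p h hp h₁, u ≠ 0 → StrictMonoOn (fun t : ℝ =>
      (∑' x, greenConv α (fun y => primitive f (t * u y)) x * f (t * u x) * u x) / t ^ p)
      (Set.Ioi 0)) :
    NehariSetting p (1 / p - 1 / θ) (energy α f) (fun u : HSpace p h hp h₁ => coupling e f u)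
      (energyDeriv e f) := by
  have hp₀ : 0 < p := by linarith
  have hθ₀ : 0 < θ := hp₀.trans hθ
  have hle (u : HSpace p h hp h₁) := le_coupling hα hαN he hf hθ₀ f₃ u
  refine
    { exponent_pos := hp₀
      continuous := continuous_energyDeriv he hf
      hasFDerivAt := hasFDerivAt_energy he hf
      apply_self := energyDeriv_apply_self he hf
      nonneg := fun u => (mul_nonneg (by positivity) (sq_nonneg _)).trans (hle u)
      lt_smul := fun hu _ ht => lt_coupling_smul he hf (f₄ _ hu) ht
      coercivity_pos := sub_pos.2 (one_div_lt_one_div_of_lt hp₀ hθ)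
      le_reduced := fun u => ?_ }
  have hθu : 1 / 2 * ‖superpos e (primitive f) u‖ ^ 2 ≤ 1 / θ * coupling e f u := by
    rw [one_div_mul_eq_div θ, le_div_iff₀ hθ₀]
    linarith [hle u]
  rw [reduced_energy he hf]
  linarith

theorem HSpace.shift_mem_nehariSet (he : ∀ x y, inner ℝ (e x) (e y) = green α x y)
    (hf : IsSmallPow (p - 1) f) {z : Fin N → ℤ} (hz : ∀ x, h (x + z) = h x) {u : HSpace p h hp h₁}
    (hu : u ∈ nehariSet (energyDeriv e f)) : u.shift z hz ∈ nehariSet (energyDeriv e f) := by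
  have hp₁ : 1 < p := by linarith
  refine ⟨norm_ne_zero_iff.1 ?_, ?_⟩
  · rw [HSpace.norm_shift]
    exact norm_ne_zero_iff.2 hu.1
  · rw [energyDeriv_apply_self he hf, HSpace.norm_shift, coupling,
      inner_superpos_shift he (hf.primitive hp₁) (hf.mul_id hp₁), ← coupling,
      ← energyDeriv_apply_self he hf, hu.2]

theorem reduced_energy_shift (he : ∀ x y, inner ℝ (e x) (e y) = green α x y)
    (hf : IsSmallPow (p - 1) f) {z : Fin N → ℤ} (hz : ∀ x, h (x + z) = h x)
    (u : HSpace p h hp h₁) :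
    reduced p (energy α f) (fun u : HSpace p h hp h₁ => coupling e f u) (u.shift z hz) =
      reduced p (energy α f) (fun u : HSpace p h hp h₁ => coupling e f u) u := by
  have hp₁ : 1 < p := by linarith
  have hF := hf.primitive hp₁
  rw [reduced_energy he hf, reduced_energy he hf, coupling, coupling,
    ← real_inner_self_eq_norm_sq, ← real_inner_self_eq_norm_sq,
    inner_superpos_shift he hF hF, inner_superpos_shift he hF (hf.mul_id hp₁)]

theorem exists_lt_abs_apply_of_mem_nehariSet (he : ∀ x y, inner ℝ (e x) (e y) = green α x y)
    (hf : IsSmallPow (p - 1) f) (M : ℝ) :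
    ∃ δ > 0, ∀ u : HSpace p h hp h₁, u ∈ nehariSet (energyDeriv e f) → ‖u‖ ≤ M →
      ∃ x, δ < |u x| := by
  have hp₁ : 1 < p := by linarith
  obtain ⟨B, hL⟩ := HSpace.exists_lpBounded_eval hp h₁
  obtain ⟨δ, hδ, hsup⟩ := hL.exists_lt_abs_apply (norm_nonneg (e 0))
    (fun x => (norm_eq_norm_zero he x).le) (hf.primitive hp₁) (hf.mul_id hp₁) M
  refine ⟨δ, hδ, fun u hu huM => hsup u hu.1 huM (le_of_eq ?_)⟩
  rw [← sub_eq_zero]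
  exact (energyDeriv_apply_self he hf u).symm.trans hu.2

theorem NehariSetting.exists_minimizing_seq
    (hN : NehariSetting p κ (energy α f) (fun u : HSpace p h hp h₁ => coupling e f u)
      (energyDeriv e f))
    (he : ∀ x y, inner ℝ (e x) (e y) = green α x y) (hf : IsSmallPow (p - 1) f)
    {T : ℤ} (hT : T ≠ 0) (h₂ : ∀ x k : Fin N → ℤ, h (x + T • k) = h x) :
    ∃ (w : ℕ → HSpace p h hp h₁) (v : HSpace p h hp h₁) (M : ℝ),
      v ≠ 0 ∧ (∀ n, w n ∈ nehariSet (energyDeriv e f)) ∧ (∀ n, ‖w n‖ ≤ M) ∧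
      Tendsto (fun n => reduced p (energy α f)
        (fun u : HSpace p h hp h₁ => coupling e f u) (w n)) atTop
        (𝓝 (sInf ((energy α f : HSpace p h hp h₁ → ℝ) '' nehariSet (energyDeriv e f)))) ∧
      ∀ x, Tendsto (fun n => w n x) atTop (𝓝 (v x)) := by
  obtain ⟨u, M, hu, hM, hlim⟩ := hN.exists_bounded_seq_tendsto_sInf
  obtain ⟨δ, hδ, hsup⟩ := exists_lt_abs_apply_of_mem_nehariSet (h₁ := h₁) he hf M
  obtain ⟨φ, k, v, hφ, hv, hpt⟩ :=
    HSpace.exists_shift_tendsto hT h₂ hδ hM fun n => hsup (u n) (hu n) (hM n)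
  refine ⟨fun n => (u (φ n)).shift (T • k n) fun x => h₂ x _, v, M, hv,
    fun n => HSpace.shift_mem_nehariSet he hf _ (hu _), fun n => ?_, ?_, hpt⟩
  · rw [HSpace.norm_shift]
    exact hM _
  · simpa only [reduced_energy_shift he hf, Function.comp_def] using hlim.comp hφ.tendsto_atTop

theorem NehariSetting.exists_isLeast_energy
    (hN : NehariSetting p κ (energy α f) (fun u : HSpace p h hp h₁ => coupling e f u)
      (energyDeriv e f)) (hα : 0 ≤ α) (hαN : α < N)
    (he : ∀ x y, inner ℝ (e x) (e y) = green α x y) (hf : IsSmallPow (p - 1) f)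
    {T : ℤ} (hT : T ≠ 0) (h₂ : ∀ x k : Fin N → ℤ, h (x + T • k) = h x) :
    ∃ v : HSpace p h hp h₁, v ∈ nehariSet (energyDeriv e f) ∧
      IsLeast ((energy α f : HSpace p h hp h₁ → ℝ) '' nehariSet (energyDeriv e f))
        (energy α f v) := by
  have hp₁ : 1 < p := by linarith
  have hF := hf.primitive hp₁
  obtain ⟨B, hL⟩ := HSpace.exists_lpBounded_eval hp h₁
  have he' : ∀ x, ‖e x‖ ≤ ‖e 0‖ := fun x => (norm_eq_norm_zero he x).le
  have hgram : ∀ y, Tendsto (fun x => inner ℝ (e x) (e y)) cofinite (𝓝 0) := fun y => by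
    simpa only [he] using tendsto_green_cofinite hα hαN y
  obtain ⟨w, v, M, hv, hw, hM, hlim, hpt⟩ := hN.exists_minimizing_seq he hf hT h₂
  have hcoupling := hL.tendsto_inner_superpos_sub hF (hf.mul_id hp₁) he' hgram hM hpt
  have hnonlocal := hL.tendsto_inner_superpos_sub hF hF he' hgram hM hpt
  refine ⟨v, hN.isLeast_of_splitting hv hw hlim (HSpace.tendsto_norm_rpow_sub hM hpt)
    hcoupling ?_⟩
  simp only [reduced_energy he hf]
  simp only [coupling, ← real_inner_self_eq_norm_sq]
  exact ((hcoupling.const_mul (1 / p)).sub (hnonlocal.const_mul (1 / 2))).congr fun n => by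
    simp only [HSpace.eval_apply]
    ring

theorem nehari_eq_nehariSet (he : ∀ x y, inner ℝ (e x) (e y) = green α x y)
    (hf : IsSmallPow (p - 1) f) :
    (nehari α f : Set (HSpace p h hp h₁)) = nehariSet (energyDeriv e f) := by
  ext v
  rw [nehari, nehariSet, Set.mem_ofPred_eq, Set.mem_ofPred_eq, (hasFDerivAt_energy he hf v).fderiv]

end Complete

end Energy

end Choquard

end

open Choquard in
theorem theorem1p1_general (N : ℕ) (p α : ℝ) (hp : 2 ≤ p) (hα : 0 < α) (hαN : α < N)
    (h : (Fin N → ℤ) → ℝ) (h₁ : ∃ h₀ > 0, ∀ x, h₀ ≤ h x)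
    (T : ℤ) (hT : T ≠ 0) (h₂ : ∀ x k : Fin N → ℤ, h (x + T • k) = h x)
    (f : ℝ → ℝ) (f₁ : Continuous f) (f₁' : f =o[𝓝[≠] 0] fun t => |t| ^ (p - 1))
    (f₃ : ∃ θ > p, ∀ t, 0 ≤ θ * primitive f t ∧ θ * primitive f t ≤ 2 * f t * t)
    (f₄ : ∀ u : HSpace p h hp h₁, u ≠ 0 → StrictMonoOn (fun t : ℝ =>
      (∑' x, greenConv α (fun y => primitive f (t * u y)) x * f (t * u x) * u x) / t ^ p)
      (Set.Ioi 0)) :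
    ContDiff ℝ 1 (energy α f : HSpace p h hp h₁ → ℝ) ∧
    ∃ u : HSpace p h hp h₁, IsGroundState α f u ∧
      ∀ x, -pLaplacian p u x + h x * |u x| ^ (p - 2) * u x =
        greenConv α (fun y => primitive f (u y)) x * f (u x) := by
  obtain ⟨θ, hθ, f₃⟩ := f₃
  have hf := isSmallPow_of_isLittleO_punctured (by linarith) f₁ f₁'
  obtain ⟨e, he⟩ := exists_inner_eq_green hα.le hαN
  have hN := nehariSetting_energy hα hαN he hf hθ f₃ f₄
  obtain ⟨u, hu, hmin⟩ := hN.exists_isLeast_energy hα.le hαN he hf hT h₂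
  have hcrit : energyDeriv e f u = 0 := hN.eq_zero_of_isLeast hu hmin
  refine ⟨contDiff_one_iff_hasFDerivAt.2 ⟨_, continuous_energyDeriv he hf,
    hasFDerivAt_energy he hf⟩, u, ⟨hu.1, hcrit ▸ hasFDerivAt_energy he hf u, ?_⟩, fun x => ?_⟩
  · rwa [nehari_eq_nehariSet he hf]
  · rw [← sub_eq_zero, ← energyDeriv_apply_single he hf, hcrit, zero_apply]

theorem theorem1p1 (N : ℕ) (p α : ℝ) (hp : 2 ≤ p) (hα : 0 < α) (hαN : α < N)
    (h : (Fin N → ℤ) → ℝ) (h₁ : ∃ h₀ > 0, ∀ x, h₀ ≤ h x)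
    (T : ℤ) (hT : T ≠ 0) (h₂ : ∀ x k : Fin N → ℤ, h (x + T • k) = h x)
    (f : ℝ → ℝ) (f₁ : Continuous f)
    (f₁' : f =o[𝓝[≠] 0] fun t => |t| ^ (p - 1))
    (f₂ : ∃ C > 0, ∃ τ > (N + α) * p / (2 * N), ∀ t, |f t| ≤ C * (1 + |t| ^ (τ - 1)))
    (f₃ : ∃ θ > p, ∀ t, 0 ≤ θ * Choquard.primitive f t ∧
      θ * Choquard.primitive f t ≤ 2 * f t * t)
    (f₄ : ∀ u : Choquard.HSpace p h hp h₁, u ≠ 0 →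
      StrictMonoOn (fun t : ℝ =>
        (∑' x, Choquard.greenConv α (fun y => Choquard.primitive f (t * u y)) x *
          f (t * u x) * u x) / t ^ p) (Set.Ioi 0)) :
    ContDiff ℝ 1 (Choquard.energy α f : Choquard.HSpace p h hp h₁ → ℝ) ∧
    ∃ u : Choquard.HSpace p h hp h₁, Choquard.IsGroundState α f u ∧
      ∀ x, -Choquard.pLaplacian p u x + h x * |u x| ^ (p - 2) * u x =
        Choquard.greenConv α (fun y => Choquard.primitive f (u y)) x * f (u x) :=
  theorem1p1_general N p α hp hα hαN h h₁ T hT h₂ f f₁ f₁' f₃ f₄
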